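/- \textbf{Setting.} Let $M\ge 1$ be an integer, $\lambda,\Gamma_{cs},P,C_L,C_N>0$, $W\ge 0$, $R_C\ge 0$ and $\alpha_N\ge\max(\alpha_L,2)$. Let the dual-slope path loss $l(r)=C_Lr^{\alpha_L}$ for $r<R_C$, $l(r)=C_Nr^{\alpha_N}$ for $r\ge R_C$, be non-decreasing on $[0,\infty)$. Base stations (BSs) form a homogeneous Poisson point process $\Phi=\{x_i\}$ of intensity $\lambda$ on $\mathbb R^2$; the typical user is at the origin. In every initial access (IA) cycle $n\ge 1$ the link from each BS to the user has a unit-mean exponential fading variable, i.i.d. over BSs and cycles and independent of $\Phi$. For $1\le i\le M$ the $i$-th BS sector $S_M(i)$ is the set of points of the plane with angle in $[2\pi (i-1)/M,2\pi i/M)$, and $x_0^i$ is the BS of smallest path loss (i.e. the closest BS) in $\Phi\cap S_M(i)$. Writing $F_x(n)$ for the fading of BS $x$ in cycle $n$, sector $i$ is detected in cycle $n$ if $$\frac{F_{x_0^i}(n)/l(\|x_0^i\|)}{\sum_{x\in\Phi\cap S_M(i)\setminus\{x_0^i\}}F_x(n)/l(\|x\|)+W/(PM)}>\Gamma_{cs}.$$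 Let $L_{cs}=\inf\{n\ge 1:\text{at least one sector is detected in cycle } n\}\in\{1,2,\dots\}\cup\{\infty\}$ and let $R_0=\min_{x\in\Phi}\|x\|$. For $j\ge 0$ and $r>0$ put $$f_j(r)=\sum_{k=0}^{j}(-1)^k\binom jk\exp\Big(-\frac{Wk\Gamma_{cs}l(r)}{PM}\Big)\exp\Big(-\frac{2\lambda\pi}{M}\int_r^\infty\Big(1-\frac1{(1+\Gamma_{cs}l(r)/l(t))^k}\Big)t\,dt\Big),$$ where the inner integral may be $+\infty$ and $e^{-\infty}=0$. \textbf{Lemma.} $L_{cs}$ is a random variable, $f_j\ge 0$ on $(0,\infty)$, the integrals below converge for every $R_0>0$, and the conditional mean number of IA cycles given the distance $R_0$ to the nearest BS is, almost surely and as an identity in $[0,\infty]$, $$\mathbb E[L_{cs}\mid R_0]=\sum_{j=0}^\infty f_j(R_0)\Big\{\int_{R_0}^\infty f_j(r)\,\frac{2\pi\lambda r}{M}\,e^{-\lambda\pi r^2/M}\,dr\Big\}^{M-1}\exp\Big(\frac{\lambda\pi(M-1)R_0^2}{M}\Big).$$ -/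

import Mathlib

open MeasureTheory ProbabilityTheory
open scoped ENNReal NNReal

namespace CellSearch

/-- Numerical parameters of the network: number `M` of beams (equivalently, of BS sectors),
BS intensity `lam`, SINR threshold `Gam`, transmit power `Pb`, thermal noise power `W`, and the
parameters of the dual-slope path loss. -/
structure Params where
  M : ℕ
  lam : ℝ
  Gam : ℝ
  Pb : ℝ
  W : ℝ
  CL : ℝ
  CN : ℝ
  αL : ℝ
  αN : ℝ
  RC : ℝ

/-- Dual-slope path loss at distance `r`. -/
noncomputable def Params.pathLoss (p : Params) (r : ℝ) : ℝ :=
  if r < p.RC then p.CL * r ^ p.αL else p.CN * r ^ p.αN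

/-- The standing assumptions on the parameters. `W = 0` (no thermal noise) is allowed. -/
structure Params.Valid (p : Params) : Prop where
  M_pos : 1 ≤ p.M
  lam_pos : 0 < p.lam
  Gam_pos : 0 < p.Gam
  Pb_pos : 0 < p.Pb
  W_nonneg : 0 ≤ p.W
  CL_pos : 0 < p.CL
  CN_pos : 0 < p.CN
  RC_nonneg : 0 ≤ p.RC
  exponent : max p.αL 2 ≤ p.αN
  pathLoss_mono : MonotoneOn p.pathLoss (Set.Ici 0)

/-- The angle of a point of the plane `ℂ = ℝ²`, in `[0, 2π)`. -/
noncomputable def angle (z : ℂ) : ℝ := toIcoMod Real.two_pi_pos 0 z.arg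

/-- The `i`-th BS sector seen from the typical user at the origin, for `i = 0, …, M - 1`. -/
def Params.sector (p : Params) (i : Fin p.M) : Set ℂ :=
  {z | angle z ∈ Set.Ico (2 * Real.pi * (i : ℝ) / p.M) (2 * Real.pi * ((i : ℝ) + 1) / p.M)}

section Model

variable {Ω : Type*}

/-- Number of points of the configuration `{x i ω}` in the set `A`. -/
noncomputable def count (x : ℕ → Ω → ℂ) (A : Set ℂ) (ω : Ω) : ℕ∞ := {i | x i ω ∈ A}.encard

/-- `x` enumerates a homogeneous Poisson point process of intensity `lam` on the plane: the number
of points in a Borel set of finite area is Poisson with mean `lam` times the area, and the numbers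
of points in finitely many disjoint such sets are independent. -/
structure IsPoissonProcess [MeasurableSpace Ω] (P : Measure Ω) (lam : ℝ) (x : ℕ → Ω → ℂ) :
    Prop where
  measurable : ∀ i, Measurable (x i)
  law : ∀ A : Set ℂ, MeasurableSet A → volume A ≠ ∞ →
    P.map (count x A) =
      (poissonMeasure (ENNReal.ofReal lam * volume A).toNNReal).map (fun n : ℕ => (n : ℕ∞))
  indep : ∀ (n : ℕ) (A : Fin n → Set ℂ), (∀ k, MeasurableSet (A k)) → (∀ k, volume (A k) ≠ ∞) →
    Pairwise (fun k l => Disjoint (A k) (A l)) → iIndepFun (fun k => count x (A k)) P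

/-- The random elements of the network: the BSs `x i` form a Poisson process; `F i n` is the
fading of the link from BS `i` to the typical user in IA cycle `n`; the fading variables are
i.i.d. exponential with unit mean over all BSs and all cycles, and independent of the BSs. -/
structure IsRayleighPoissonNetwork [MeasurableSpace Ω] (P : Measure Ω) (lam : ℝ)
    (x : ℕ → Ω → ℂ) (F : ℕ → ℕ → Ω → ℝ) : Prop where
  poisson : IsPoissonProcess P lam x
  fading_measurable : ∀ i n, Measurable (F i n)
  fading_law : ∀ i n, P.map (F i n) = expMeasure 1
  fading_iIndep : iIndepFun (fun q : ℕ × ℕ => F q.1 q.2) P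
  fading_indep : IndepFun (fun ω i => x i ω) (fun ω (q : ℕ × ℕ) => F q.1 q.2 ω) P

/-- BS `a` is the BS providing the smallest path loss, i.e. the closest BS, in sector `i`. -/
def Params.IsBestInSector (p : Params) (x : ℕ → Ω → ℂ) (i : Fin p.M) (a : ℕ) (ω : Ω) : Prop :=
  x a ω ∈ p.sector i ∧
    ∀ b, x b ω ∈ p.sector i →
      p.pathLoss ‖x a ω‖ ≤ p.pathLoss ‖x b ω‖ ∧ ‖x a ω‖ ≤ ‖x b ω‖

/-- Received power from BS `b` in cycle `n`, normalised by transmit power and antenna gain. -/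
noncomputable def Params.rxPower (p : Params) (x : ℕ → Ω → ℂ) (F : ℕ → ℕ → Ω → ℝ)
    (n b : ℕ) (ω : Ω) : ℝ≥0∞ :=
  ENNReal.ofReal (F b n ω / p.pathLoss ‖x b ω‖)

/-- Interference in cycle `n` from all BSs of sector `i` other than `a`; it may be infinite. -/
noncomputable def Params.interference (p : Params) (x : ℕ → Ω → ℂ) (F : ℕ → ℕ → Ω → ℝ)
    (n : ℕ) (i : Fin p.M) (a : ℕ) (ω : Ω) : ℝ≥0∞ :=
  ∑' b, Set.indicator {b | b ≠ a ∧ x b ω ∈ p.sector i} (fun b => p.rxPower x F n b ω) b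

/-- SINR in cycle `n` of the synchronization signal from BS `a` of sector `i`. -/
noncomputable def Params.sinr (p : Params) (x : ℕ → Ω → ℂ) (F : ℕ → ℕ → Ω → ℝ)
    (n : ℕ) (i : Fin p.M) (a : ℕ) (ω : Ω) : ℝ≥0∞ :=
  p.rxPower x F n a ω / (p.interference x F n i a ω + ENNReal.ofReal (p.W / (p.Pb * p.M)))

/-- Sector `i` is detected in cycle `n`. -/
def Params.SectorDetected (p : Params) (x : ℕ → Ω → ℂ) (F : ℕ → ℕ → Ω → ℝ)
    (n : ℕ) (i : Fin p.M) (ω : Ω) : Prop :=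
  ∃ a, p.IsBestInSector x i a ω ∧ ENNReal.ofReal p.Gam < p.sinr x F n i a ω

/-- Cell search succeeds in cycle `n`: at least one sector is detected. -/
def Params.Success (p : Params) (x : ℕ → Ω → ℂ) (F : ℕ → ℕ → Ω → ℝ) (n : ℕ) (ω : Ω) : Prop :=
  ∃ i, p.SectorDetected x F n i ω

/-- Number of IA cycles to succeed in cell search, `∞` if it never succeeds. -/
noncomputable def Params.numCycles (p : Params) (x : ℕ → Ω → ℂ) (F : ℕ → ℕ → Ω → ℝ)
    (ω : Ω) : ℝ≥0∞ :=
  ⨅ (n : ℕ) (_ : 1 ≤ n) (_ : p.Success x F n ω), (n : ℝ≥0∞)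

/-- Distance from the typical user, at the origin, to its nearest BS. -/
noncomputable def nearestDist (x : ℕ → Ω → ℂ) (ω : Ω) : ℝ := ⨅ i, ‖x i ω‖

end Model

/-- `exp (-a)` for `a ∈ [0, ∞]`, with `exp (-∞) = 0`. -/
noncomputable def expNeg (a : ℝ≥0∞) : ℝ := if a = ∞ then 0 else Real.exp (-a.toReal)

/-- The function `f_j`. The integral over distances is taken in `[0, ∞]`: it diverges for `k ≥ 1`
when `αN = 2`, and the corresponding term is then zero. -/
noncomputable def Params.f (p : Params) (j : ℕ) (r : ℝ) : ℝ :=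
  ∑ k ∈ Finset.range (j + 1), (-1 : ℝ) ^ k * (j.choose k : ℝ) *
    Real.exp (-(p.W * k * p.Gam * p.pathLoss r / (p.Pb * p.M))) *
    expNeg (ENNReal.ofReal (2 * p.lam * Real.pi / p.M) *
      ∫⁻ t in Set.Ioi r,
        ENNReal.ofReal ((1 - 1 / (1 + p.Gam * p.pathLoss r / p.pathLoss t) ^ k) * t))

/-- The probability density of the distance to the nearest BS of one sector. -/
noncomputable def Params.sectorDensity (p : Params) (r : ℝ) : ℝ :=
  p.lam * 2 * Real.pi * r / p.M * Real.exp (-(p.lam * Real.pi * r ^ 2 / p.M))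

/-- The `j`-th term of the series for the conditional mean number of cycles given `R₀ = r`. -/
noncomputable def Params.term (p : Params) (j : ℕ) (r : ℝ) : ℝ :=
  p.f j r * (∫ t in Set.Ioi r, p.f j t * p.sectorDensity t) ^ (p.M - 1) *
    Real.exp (p.lam * Real.pi * ((p.M : ℝ) - 1) * r ^ 2 / p.M)

end CellSearch

namespace CellSearch

open Filter Topology

/-! ### The function `a ↦ exp (-a)` on `[0, ∞]` -/

/-! The number of cycles is the sum over `j ≥ 0` of the indicators of "no success in cycles `1, …,
j`" (`numCycles_eq_tsum`), so the j-th term of the series must be the conditional probability of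
that event given `R₀`.

Freeze the base stations. The detections of the various sectors in the various cycles use disjoint
families of fading variables, hence are independent. Averaging over the exponential signal turns a
detection probability into a Laplace transform of the interference, which factors over the
interferers: a sector with nearest station at distance `r` is detected with probability `D = exp
(-noise - ∑ log (1 + Γ l(r) / l(t)))`, the sum being over its farther stations at distances `t`.
Thus all sectors are missed `j` times with probability `∏ (1 - D_i) ^ j` (`measure_no_success`).

Now average over the Poisson process. Beyond a fixed `r`, the generating functional gives the
moments of `D`, and the binomial formula gives `E (1 - D) ^ j = f_j(r)` (`lintegral_missProb`). In
particular `f_j` is an expectation, so it lies in `[0, 1]`. Distinct sectors are independent, and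
within a sector the points beyond `r` are independent of those within `r`. Hence, weighted by the
miss probabilities, the distances `R_i` of the sectors have the product law with factors `f_j` times
the law of one `R_i` (`lintegral_prod_missProb`, `map_secRad_withDensity`). The radius is random, so
the independence is applied after rounding it up to a grid; right continuity and dominated
convergence recover the exact statement.

Finally `R₀` is the minimum of the `R_i`. For a diffuse finite law `η`, the minimum of `M`
independent copies has law `M η((r, ∞)) ^ (M - 1) η(dr)`. Applied to `missLaw j` this describes `R₀`
on the event of `j` failures; with `j = 0` it is the law of `R₀` itself. Their ratio is the j-th
term (`ofReal_term_mul`), and the identities integrated over `{R₀ ∈ B}` characterize the conditional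
expectation. -/

@[simp] lemma expNeg_zero : expNeg 0 = 1 := by simp [expNeg]

@[simp] lemma expNeg_top : expNeg ∞ = 0 := by simp [expNeg]

lemma expNeg_ofReal {a : ℝ} (ha : 0 ≤ a) : expNeg (ENNReal.ofReal a) = Real.exp (-a) := by
  simp [expNeg, ha]

lemma expNeg_nonneg (a : ℝ≥0∞) : 0 ≤ expNeg a := by
  unfold expNeg; split_ifs <;> positivity

lemma expNeg_le_one (a : ℝ≥0∞) : expNeg a ≤ 1 := by
  unfold expNeg; split_ifs <;> simp

lemma expNeg_add (a b : ℝ≥0∞) : expNeg (a + b) = expNeg a * expNeg b := by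
  by_cases ha : a = ∞
  · simp [ha]
  by_cases hb : b = ∞
  · simp [hb]
  simp [expNeg, ha, hb, ENNReal.toReal_add ha hb, Real.exp_add, mul_comm]

lemma expNeg_nat_mul (k : ℕ) (a : ℝ≥0∞) : expNeg (k * a) = expNeg a ^ k := by
  induction k with
  | zero => simp
  | succ k ih => rw [pow_succ, ← ih, ← expNeg_add]; congr 1; push_cast; ring

/-- Gives continuity at `∞` too, borrowed from the exponential on the extended reals. Divergent
interference sums and integrals then need no separate treatment in the limits below. -/
lemma expNeg_eq_erealExp (a : ℝ≥0∞) : ENNReal.ofReal (expNeg a) = EReal.exp (-(a : EReal)) := by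
  induction a with
  | top => simp
  | coe a => simp [expNeg]; rfl

lemma continuous_ofReal_expNeg : Continuous fun a : ℝ≥0∞ => ENNReal.ofReal (expNeg a) := by
  simp_rw [expNeg_eq_erealExp]
  exact ENNReal.continuous_exp.comp (continuous_neg.comp continuous_coe_ennreal_ereal)

/-- `exp (-a)` for `a ∈ [0, ∞]`, as an element of `[0, ∞]`. -/
noncomputable def eexpNeg (a : ℝ≥0∞) : ℝ≥0∞ := ENNReal.ofReal (expNeg a)

lemma continuous_eexpNeg : Continuous eexpNeg := continuous_ofReal_expNeg

lemma measurable_eexpNeg : Measurable eexpNeg := continuous_eexpNeg.measurable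

lemma toReal_eexpNeg (a : ℝ≥0∞) : (eexpNeg a).toReal = expNeg a :=
  ENNReal.toReal_ofReal (expNeg_nonneg a)

lemma measurable_expNeg : Measurable expNeg := by
  have : expNeg = fun a => (eexpNeg a).toReal := by ext a; rw [toReal_eexpNeg]
  rw [this]
  exact measurable_eexpNeg.ennreal_toReal

@[simp] lemma eexpNeg_zero : eexpNeg 0 = 1 := by simp [eexpNeg]

@[simp] lemma eexpNeg_top : eexpNeg ∞ = 0 := by simp [eexpNeg]

lemma eexpNeg_le_one (a : ℝ≥0∞) : eexpNeg a ≤ 1 := by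
  simpa [eexpNeg] using expNeg_le_one a

lemma eexpNeg_add (a b : ℝ≥0∞) : eexpNeg (a + b) = eexpNeg a * eexpNeg b := by
  rw [eexpNeg, expNeg_add, ENNReal.ofReal_mul (expNeg_nonneg a), eexpNeg, eexpNeg]

lemma eexpNeg_nat_mul (k : ℕ) (a : ℝ≥0∞) : eexpNeg (k * a) = eexpNeg a ^ k := by
  rw [eexpNeg, expNeg_nat_mul, ENNReal.ofReal_pow (expNeg_nonneg a), eexpNeg]

lemma eexpNeg_sum {ι : Type*} (s : Finset ι) (a : ι → ℝ≥0∞) :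
    eexpNeg (∑ i ∈ s, a i) = ∏ i ∈ s, eexpNeg (a i) := by
  classical
  induction s using Finset.induction_on with
  | empty => simp
  | insert i s hi ih => rw [Finset.sum_insert hi, Finset.prod_insert hi, eexpNeg_add, ih]

lemma eexpNeg_ofReal {a : ℝ} (ha : 0 ≤ a) :
    eexpNeg (ENNReal.ofReal a) = ENNReal.ofReal (Real.exp (-a)) := by
  rw [eexpNeg, expNeg_ofReal ha]

/-! ### Independence -/

section Independence

variable {Ω : Type*} [MeasurableSpace Ω] {P : Measure Ω}

/-- Induction on `s`: the group `S q` is disjoint from the union of the groups already treated, so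
the σ-algebras they generate are independent. Used for the fadings, grouped by sector and cycle, and
for the atoms of a finite family of regions. -/
lemma measure_biInter_of_disjoint_groups {ι κ : Type*} [IsProbabilityMeasure P]
    {m : ι → MeasurableSpace Ω}
    (hle : ∀ i, m i ≤ ‹MeasurableSpace Ω›) (hind : iIndep m P) (S : κ → Set ι)
    (hS : Pairwise fun a b => Disjoint (S a) (S b)) (s : Finset κ) (E : κ → Set Ω)
    (hE : ∀ q ∈ s, MeasurableSet[⨆ i ∈ S q, m i] (E q)) :
    P (⋂ q ∈ s, E q) = ∏ q ∈ s, P (E q) := by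
  classical
  induction s using Finset.induction_on with
  | empty => simp
  | insert q s hq ih =>
    rw [Finset.prod_insert hq, ← ih fun r hr => hE r (Finset.mem_insert_of_mem hr),
      Finset.set_biInter_insert]
    have hd : Disjoint (S q) (⋃ r ∈ s, S r) := by
      rw [Set.disjoint_iUnion₂_right]
      intro r hr
      exact hS (by rintro rfl; exact hq hr)
    refine (Indep_iff _ _ _).1 (indep_iSup_of_disjoint hle hind hd) _ _
      (hE q (Finset.mem_insert_self _ _)) ?_
    refine MeasurableSet.biInter (Finset.countable_toSet s) fun r hr => ?_
    refine (iSup₂_le fun i hi => ?_ : (⨆ i ∈ S r, m i) ≤ _) _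
      (hE r (Finset.mem_insert_of_mem hr))
    exact le_iSup₂_of_le i (Set.mem_biUnion hr hi) le_rfl

/-- Partial sums factor by independence; the integrands are bounded by 1, and `eexpNeg` is
continuous on all of `[0, ∞]`, so the limit is legitimate even when the sums diverge. -/
lemma lintegral_eexpNeg_tsum [IsProbabilityMeasure P] (Y : ℕ → Ω → ℝ≥0∞) (c : ℕ → ℝ≥0∞)
    (hY : iIndepFun Y P)
    (hm : ∀ b, Measurable (Y b)) (hc : ∀ b, ∫⁻ ω, eexpNeg (Y b ω) ∂P = eexpNeg (c b)) :
    ∫⁻ ω, eexpNeg (∑' b, Y b ω) ∂P = eexpNeg (∑' b, c b) := by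
  have hfin (n : ℕ) : ∫⁻ ω, eexpNeg (∑ b ∈ Finset.range n, Y b ω) ∂P
      = eexpNeg (∑ b ∈ Finset.range n, c b) := by
    simp_rw [eexpNeg_sum]
    rw [lintegral_prod_eq_prod_lintegral_of_indepFun _ (fun b ω => eexpNeg (Y b ω))
      (hY.comp (fun _ => eexpNeg) fun _ => measurable_eexpNeg)
      fun b => measurable_eexpNeg.comp (hm b)]
    simp_rw [hc]
  have h1 : Tendsto (fun n => ∫⁻ ω, eexpNeg (∑ b ∈ Finset.range n, Y b ω) ∂P) atTop
      (𝓝 (∫⁻ ω, eexpNeg (∑' b, Y b ω) ∂P)) := by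
    refine tendsto_lintegral_of_dominated_convergence (fun _ => 1) (fun n => ?_)
      (fun n => ae_of_all _ fun ω => eexpNeg_le_one _) (by simp)
      (ae_of_all _ fun ω => ?_)
    · exact measurable_eexpNeg.comp (Finset.measurable_fun_sum _ fun b _ => hm b)
    · exact (continuous_eexpNeg.tendsto _).comp ENNReal.summable.hasSum.tendsto_sum_nat
  have h2 : Tendsto (fun n => eexpNeg (∑ b ∈ Finset.range n, c b)) atTop
      (𝓝 (eexpNeg (∑' b, c b))) :=
    (continuous_eexpNeg.tendsto _).comp ENNReal.summable.hasSum.tendsto_sum_nat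
  simp_rw [hfin] at h1
  exact tendsto_nhds_unique h1 h2

/-! ### Exponential fading -/

lemma expMeasure_one_Iic (a : ℝ) :
    expMeasure 1 (Set.Iic a) = ENNReal.ofReal (if 0 ≤ a then 1 - Real.exp (-a) else 0) := by
  have := lintegral_exponentialPDF_eq_antiDeriv (r := 1) one_pos a
  rw [one_mul] at this
  rw [← this]
  -- The exponential law is by definition the Gamma law of shape 1.
  change (volume.withDensity (gammaPDF 1 1)) _ = _
  rw [withDensity_apply _ measurableSet_Iic]
  rfl

lemma expMeasure_one_Ioi {a : ℝ} (ha : 0 ≤ a) :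
    expMeasure 1 (Set.Ioi a) = ENNReal.ofReal (Real.exp (-a)) := by
  have := isProbabilityMeasure_expMeasure (r := 1) one_pos
  rw [← Set.compl_Iic, prob_compl_eq_one_sub measurableSet_Iic, expMeasure_one_Iic, if_pos ha,
    ← ENNReal.ofReal_one, ← ENNReal.ofReal_sub _ (by simpa using ha)]
  congr 1
  ring

/-- The exponential tail. Truncating negative values of `X` is harmless because the threshold is
nonnegative, and an infinite threshold gives zero on both sides. -/
lemma measure_lt_ofReal_div {X : Ω → ℝ} (hX : Measurable X) (hlaw : P.map X = expMeasure 1)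
    {l : ℝ} (hl : 0 < l) (y : ℝ≥0∞) :
    P {ω | y < ENNReal.ofReal (X ω / l)} = eexpNeg (ENNReal.ofReal l * y) := by
  by_cases hy : y = ∞
  · simp [hy, ENNReal.mul_top, hl]
  lift y to ℝ≥0 using hy
  have : {ω | (y : ℝ≥0∞) < ENNReal.ofReal (X ω / l)} = X ⁻¹' Set.Ioi (l * y) := by
    ext ω
    simp only [Set.mem_ofPred_eq, Set.mem_preimage, Set.mem_Ioi]
    rw [← ENNReal.ofReal_coe_nnreal, ENNReal.ofReal_lt_ofReal_iff', lt_div_iff₀' hl]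
    constructor
    · exact fun h => h.1
    · intro h
      refine ⟨h, div_pos (lt_of_le_of_lt (by positivity) h) hl⟩
  rw [this, ← Measure.map_apply hX measurableSet_Ioi, hlaw, expMeasure_one_Ioi (by positivity),
    ← ENNReal.ofReal_coe_nnreal, ← ENNReal.ofReal_mul hl.le, eexpNeg_ofReal (by positivity)]

lemma lintegral_exp_neg_mul_Ioi {c : ℝ} (hc : 0 < c) :
    ∫⁻ x in Set.Ioi (0 : ℝ), ENNReal.ofReal (Real.exp (-c * x)) = ENNReal.ofReal (1 / c) := by
  rw [← ofReal_integral_eq_lintegral_ofReal (integrableOn_exp_mul_Ioi (by linarith) 0)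
    (ae_of_all _ fun x => (Real.exp_pos _).le), integral_exp_mul_Ioi (by linarith)]
  simp

/-- The Laplace transform `1 / (1 + c)`, written as `exp (-log (1 + c))` so that the product over
interferers becomes the exponential of a sum over points. -/
lemma lintegral_eexpNeg_expMeasure {c : ℝ} (hc : 0 ≤ c) :
    ∫⁻ x, eexpNeg (ENNReal.ofReal (c * x)) ∂(expMeasure 1)
      = eexpNeg (ENNReal.ofReal (Real.log (1 + c))) := by
  have hm : Measurable (gammaPDF 1 1) := (measurable_gammaPDFReal 1 1).ennreal_ofReal
  change ∫⁻ x, _ ∂(volume.withDensity (gammaPDF 1 1)) = _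
  rw [lintegral_withDensity_eq_lintegral_mul _ hm
    (g := fun x => eexpNeg (ENNReal.ofReal (c * x))) (measurable_eexpNeg.comp (by fun_prop))]
  have h0 : ∀ x : ℝ, (gammaPDF 1 1 * fun x => eexpNeg (ENNReal.ofReal (c * x))) x
      = (Set.Ici (0 : ℝ)).indicator (fun x => ENNReal.ofReal (Real.exp (-(1 + c) * x))) x := by
    intro x
    rw [Pi.mul_apply]
    by_cases hx : 0 ≤ x
    · have : gammaPDF 1 1 x = ENNReal.ofReal (1 * Real.exp (-(1 * x))) :=
        exponentialPDF_of_nonneg (r := 1) hx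
      rw [this, Set.indicator_of_mem (Set.mem_Ici.2 hx), eexpNeg_ofReal (by positivity),
        ← ENNReal.ofReal_mul (by positivity), one_mul, ← Real.exp_add]
      congr 2; ring
    · rw [gammaPDF_of_neg (not_le.1 hx), Set.indicator_of_notMem (by simpa using hx), zero_mul]
  simp_rw [h0]
  rw [lintegral_indicator measurableSet_Ici, setLIntegral_congr Ioi_ae_eq_Ici.symm,
    lintegral_exp_neg_mul_Ioi (by linarith), eexpNeg_ofReal (Real.log_nonneg (by linarith)),
    Real.exp_neg, Real.exp_log (by linarith), one_div]

end Independence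


/-! ### Path loss and sectors -/

lemma Params.Valid.pathLoss_pos {p : Params} (hp : p.Valid) {r : ℝ} (hr : 0 < r) :
    0 < p.pathLoss r := by
  have := hp.CL_pos
  have := hp.CN_pos
  unfold Params.pathLoss
  split_ifs <;> positivity

lemma Params.measurable_pathLoss (p : Params) : Measurable p.pathLoss := by
  unfold Params.pathLoss
  exact Measurable.ite measurableSet_Iio (by fun_prop) (by fun_prop)

lemma measurable_angle : Measurable angle := by
  have : angle = fun z : ℂ => if 0 ≤ z.arg then z.arg else z.arg + 2 * Real.pi := by
    ext z
    unfold angle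
    split_ifs with h
    · rw [toIcoMod_eq_self]
      exact ⟨h, by linarith [Complex.arg_le_pi z, Real.pi_pos]⟩
    · rw [← toIcoMod_add_right, toIcoMod_eq_self]
      exact ⟨by linarith [Complex.neg_pi_lt_arg z, Real.pi_pos], by linarith⟩
  rw [this]
  exact Measurable.ite (measurableSet_le measurable_const Complex.measurable_arg)
    Complex.measurable_arg (Complex.measurable_arg.add_const _)

lemma Params.measurableSet_sector (p : Params) (i : Fin p.M) : MeasurableSet (p.sector i) :=
  measurable_angle measurableSet_Ico

lemma angle_mem_Ico (z : ℂ) : angle z ∈ Set.Ico 0 (2 * Real.pi) := by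
  simpa [angle] using toIcoMod_mem_Ico Real.two_pi_pos 0 z.arg

lemma Params.Valid.exists_mem_sector {p : Params} (hp : p.Valid) (z : ℂ) :
    ∃ i, z ∈ p.sector i := by
  have hM : (0 : ℝ) < p.M := by exact_mod_cast hp.M_pos
  have hz := angle_mem_Ico z
  have h2 := Real.two_pi_pos
  set y := angle z * p.M / (2 * Real.pi) with hy
  have hy0 : 0 ≤ y := by have := hz.1; positivity
  have hyM : y < p.M := by
    rw [hy, div_lt_iff₀ h2, mul_comm]
    exact mul_lt_mul_of_pos_left hz.2 hM
  have haz : angle z = 2 * Real.pi * y / p.M := by rw [hy]; field_simp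
  refine ⟨⟨⌊y⌋₊, (Nat.floor_lt hy0).2 hyM⟩, ?_, ?_⟩
  · rw [haz]
    have := Nat.floor_le hy0
    gcongr
  · rw [haz]
    have := Nat.lt_floor_add_one y
    gcongr

lemma Params.Valid.disjoint_sector {p : Params} (hp : p.Valid) :
    Pairwise fun i j => Disjoint (p.sector i) (p.sector j) := by
  have hM : (0 : ℝ) < p.M := by exact_mod_cast hp.M_pos
  have key : ∀ i j : Fin p.M, ∀ z, z ∈ p.sector i → z ∈ p.sector j → i ≤ j := by
    intro i j z hi hj
    have h := hi.1.trans_lt hj.2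
    rw [div_lt_div_iff_of_pos_right hM] at h
    have h' : (i : ℝ) < j + 1 := lt_of_mul_lt_mul_left h Real.two_pi_pos.le
    have : (i : ℕ) < (j : ℕ) + 1 := by exact_mod_cast h'
    exact Fin.le_def.2 (by omega)
  intro i j hij
  rw [Set.disjoint_left]
  exact fun z hi hj => hij (le_antisymm (key i j z hi hj) (key j i z hj hi))

/-! ### Detection for a deterministic configuration of base stations -/

/-- `log (1 + Γ l(r) / l(t))`, the attenuation exponent due to an interferer at distance `t`. -/
noncomputable def Params.logAtten (p : Params) (r t : ℝ) : ℝ≥0∞ :=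
  ENNReal.ofReal (Real.log (1 + p.Gam * p.pathLoss r / p.pathLoss t))

/-- The exponent `Γ l(r) W / (P M)` due to thermal noise. -/
noncomputable def Params.noiseExp (p : Params) (r : ℝ) : ℝ≥0∞ :=
  ENNReal.ofReal (p.Gam * p.pathLoss r * (p.W / (p.Pb * p.M)))

/-- The points of sector `i` at distance more than `r`. -/
def Params.farSector (p : Params) (i : Fin p.M) (r : ℝ) : Set ℂ := p.sector i ∩ {w | r < ‖w‖}

/-- The attenuation exponent due to all interferers of sector `i` farther than `r`. -/
noncomputable def Params.interfExp (p : Params) (i : Fin p.M) (r : ℝ) (z : ℕ → ℂ) : ℝ≥0∞ :=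
  ∑' b, (p.farSector i r).indicator (fun w => p.logAtten r ‖w‖) (z b)

/-- Conditional probability of detection of sector `i` given the configuration `z` of BSs, if the
nearest BS of the sector is at distance `r`. -/
noncomputable def Params.detProb (p : Params) (i : Fin p.M) (r : ℝ) (z : ℕ → ℂ) : ℝ≥0∞ :=
  eexpNeg (p.noiseExp r + p.interfExp i r z)

/-- BS `a` is the only nearest BS of sector `i`, and it is not at the origin. -/
def Params.UniqueBest (p : Params) (z : ℕ → ℂ) (i : Fin p.M) (a : ℕ) : Prop :=
  z a ∈ p.sector i ∧ 0 < ‖z a‖ ∧ ∀ b, b ≠ a → z b ∈ p.sector i → ‖z a‖ < ‖z b‖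

lemma Params.Valid.noise_nonneg {p : Params} (hp : p.Valid) : 0 ≤ p.W / (p.Pb * p.M) :=
  div_nonneg hp.W_nonneg (mul_nonneg hp.Pb_pos.le (Nat.cast_nonneg _))

section Deterministic

variable {Ω : Type*} {p : Params} {F : ℕ → ℕ → Ω → ℝ} {z : ℕ → ℂ}

/-- The denominator vanishes when there is neither noise nor interference. Then `x / 0 = ∞` for `x ≠
0` and `0 / 0 = 0`, so both sides say that `x` is nonzero. -/
lemma lt_div_iff_mul_lt_of_pos {g x y : ℝ≥0∞} (hg : g ≠ 0) (hg' : g ≠ ∞) :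
    g < x / y ↔ g * y < x := by
  by_cases hy0 : y = 0
  · subst hy0
    by_cases hx0 : x = 0
    · simp [hx0]
    · simp [ENNReal.div_zero hx0, hg'.lt_top, pos_iff_ne_zero, hx0]
  · rw [ENNReal.lt_div_iff_mul_lt (Or.inl hy0) (Or.inr hg)]

/-- Uniqueness of the nearest station removes the existential in detection; monotonicity of the path
loss makes the nearest station also the one of least loss. -/
lemma Params.UniqueBest.sectorDetected_iff (hp : p.Valid) {i : Fin p.M} {a : ℕ}
    (ha : p.UniqueBest z i a) (n : ℕ) (ω : Ω) :
    p.SectorDetected (fun b _ => z b) F n i ω ↔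
      ENNReal.ofReal p.Gam * (p.interference (fun b _ => z b) F n i a ω +
        ENNReal.ofReal (p.W / (p.Pb * p.M))) < ENNReal.ofReal (F a n ω / p.pathLoss ‖z a‖) := by
  rw [← lt_div_iff_mul_lt_of_pos (by simpa using hp.Gam_pos) ENNReal.ofReal_ne_top]
  constructor
  · rintro ⟨c, hc, h⟩
    have : c = a := by
      by_contra hca
      exact absurd (ha.2.2 c hca hc.1) (not_lt.2 (hc.2 a ha.1).2)
    subst this
    exact h
  · intro h
    refine ⟨a, ⟨ha.1, fun b hb => ?_⟩, h⟩
    have hab : ‖z a‖ ≤ ‖z b‖ := by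
      by_cases hba : b = a
      · rw [hba]
      · exact (ha.2.2 b hba hb).le
    exact ⟨hp.pathLoss_mono (Set.mem_Ici.2 (norm_nonneg _)) (Set.mem_Ici.2 (norm_nonneg _)) hab,
      hab⟩

/-- The σ-algebra `m` is arbitrary so that it can be the one generated by a chosen set of fadings:
this records which fadings the interference depends on, as the independence arguments require. -/
lemma measurable_interference_aux (m : MeasurableSpace Ω) (i : Fin p.M) (a n : ℕ)
    (hF : ∀ b, b ≠ a → z b ∈ p.sector i → Measurable[m] (F b n)) :
    Measurable[m] (p.interference (fun b _ => z b) F n i a) := by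
  unfold Params.interference
  refine Measurable.tsum fun b => ?_
  by_cases hb : b ≠ a ∧ z b ∈ p.sector i
  · have : (fun ω => Set.indicator {b | b ≠ a ∧ z b ∈ p.sector i}
        (fun b => p.rxPower (fun b _ => z b) F n b ω) b)
        = fun ω => p.rxPower (fun b _ => z b) F n b ω := by
      ext ω; exact Set.indicator_of_mem (s := {b | b ≠ a ∧ z b ∈ p.sector i}) hb _
    rw [this]
    exact ((hF b hb.1 hb.2).div_const _).ennreal_ofReal
  · have : (fun ω => Set.indicator {b | b ≠ a ∧ z b ∈ p.sector i}
        (fun b => p.rxPower (fun b _ => z b) F n b ω) b) = fun ω => 0 := by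
      ext ω; exact Set.indicator_of_notMem (s := {b | b ≠ a ∧ z b ∈ p.sector i}) hb _
    rw [this]
    exact measurable_const

variable [MeasurableSpace Ω] {P : Measure Ω} [IsProbabilityMeasure P]

/-- Detection means that the signal fading exceeds `l * Y`, where `Y` depends on other fadings only.
Integrating the signal first gives `E exp (-l * Y)`; then `l * Y` is the noise exponent plus a
weighted sum of independent exponentials, whose Laplace transform is a product. -/
lemma Params.UniqueBest.measure_sectorDetected (hp : p.Valid)
    (hFm : ∀ i n, Measurable (F i n)) (hFl : ∀ i n, P.map (F i n) = expMeasure 1)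
    (hFi : iIndepFun (fun q : ℕ × ℕ => F q.1 q.2) P) {i : Fin p.M} {a : ℕ}
    (ha : p.UniqueBest z i a) (n : ℕ) :
    P {ω | p.SectorDetected (fun b _ => z b) F n i ω} = p.detProb i ‖z a‖ z := by
  set l := p.pathLoss ‖z a‖ with hl
  have hl0 : 0 < l := hp.pathLoss_pos ha.2.1
  set w := ENNReal.ofReal (p.W / (p.Pb * p.M)) with hw
  set Y : Ω → ℝ≥0∞ := fun ω => ENNReal.ofReal p.Gam *
    (p.interference (fun b _ => z b) F n i a ω + w) with hY
  have hint : Measurable (p.interference (fun b _ => z b) F n i a) :=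
    measurable_interference_aux _ i a n fun b _ _ => hFm b n
  have hYm : Measurable Y := (hint.add_const _).const_mul _
  -- independence of the signal and the interference
  have hind : IndepFun Y (F a n) P := by
    rw [IndepFun_iff_Indep]
    have hd : Disjoint {q : ℕ × ℕ | q.1 ≠ a ∧ q.2 = n} {(a, n)} := by
      rw [Set.disjoint_singleton_right]; simp
    have hI := indep_iSup_of_disjoint (m := fun q : ℕ × ℕ => MeasurableSpace.comap (F q.1 q.2)
      inferInstance) (fun q => (hFm q.1 q.2).comap_le) hFi.iIndep hd
    refine indep_of_indep_of_le_left (indep_of_indep_of_le_right hI ?_) ?_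
    · exact le_iSup₂_of_le (a, n) rfl le_rfl
    · refine Measurable.comap_le (Measurable.const_mul (Measurable.add_const ?_ _) _)
      refine measurable_interference_aux _ i a n fun b hb _ => ?_
      exact Measurable.mono (comap_measurable (F b n)) (le_iSup₂_of_le
        (f := fun (q : ℕ × ℕ) (_ : q ∈ {q : ℕ × ℕ | q.1 ≠ a ∧ q.2 = n}) =>
          MeasurableSpace.comap (F q.1 q.2) inferInstance) (b, n) ⟨hb, rfl⟩ le_rfl) le_rfl
  have hset : {ω | p.SectorDetected (fun b _ => z b) F n i ω}
      = (fun ω => (Y ω, F a n ω)) ⁻¹' {q | q.1 < ENNReal.ofReal (q.2 / l)} := by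
    ext ω
    exact ha.sectorDetected_iff hp n ω
  have hms : MeasurableSet {q : ℝ≥0∞ × ℝ | q.1 < ENNReal.ofReal (q.2 / l)} :=
    measurableSet_lt measurable_fst (measurable_snd.div_const _).ennreal_ofReal
  rw [hset, ← Measure.map_apply (hYm.prodMk (hFm a n)) hms,
    (indepFun_iff_map_prod_eq_prod_map_map hYm.aemeasurable (hFm a n).aemeasurable).1 hind,
    Measure.prod_apply hms, lintegral_map (measurable_measure_prodMk_left hms) hYm]
  have h1 : ∀ y : ℝ≥0∞, (P.map (F a n)) (Prod.mk y ⁻¹' {q | q.1 < ENNReal.ofReal (q.2 / l)})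
      = eexpNeg (ENNReal.ofReal l * y) := by
    intro y
    rw [Measure.map_apply (hFm a n) (measurable_prodMk_left hms)]
    exact measure_lt_ofReal_div (hFm a n) (hFl a n) hl0 y
  simp_rw [h1]
  -- split off the noise
  set T : Set ℕ := {b | b ≠ a ∧ z b ∈ p.sector i}
  set c : ℕ → ℝ := fun b => p.Gam * l / p.pathLoss ‖z b‖ with hc
  have hTpos : ∀ b ∈ T, 0 < p.pathLoss ‖z b‖ := fun b hb =>
    hp.pathLoss_pos (ha.2.1.trans (ha.2.2 b hb.1 hb.2))
  have hsplit : ∀ ω, ENNReal.ofReal l * Y ω = p.noiseExp ‖z a‖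
      + ∑' b, T.indicator (fun b => ENNReal.ofReal (c b * F b n ω)) b := by
    intro ω
    rw [hY]
    simp only
    rw [← mul_assoc, ← ENNReal.ofReal_mul hl0.le, mul_add, add_comm]
    congr 1
    · rw [hw, ← ENNReal.ofReal_mul (mul_nonneg hl0.le hp.Gam_pos.le), Params.noiseExp,
        mul_comm l]
    · rw [Params.interference, ← ENNReal.tsum_mul_left]
      congr 1
      ext b
      by_cases hb : b ∈ T
      · rw [Set.indicator_of_mem hb, Set.indicator_of_mem (s := {b | b ≠ a ∧ z b ∈ p.sector i}) hb,
          Params.rxPower, ← ENNReal.ofReal_mul (mul_nonneg hl0.le hp.Gam_pos.le)]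
        congr 1
        simp only [hc]
        ring
      · rw [Set.indicator_of_notMem hb,
          Set.indicator_of_notMem (s := {b | b ≠ a ∧ z b ∈ p.sector i}) hb, mul_zero]
  simp_rw [hsplit, eexpNeg_add]
  have hmY : ∀ b, Measurable fun y : ℝ => T.indicator (fun b => ENNReal.ofReal (c b * y)) b := by
    intro b
    by_cases hb : b ∈ T
    · simp only [Set.indicator_of_mem hb]; fun_prop
    · simp only [Set.indicator_of_notMem hb]; fun_prop
  have hmT : Measurable fun ω =>
      eexpNeg (∑' b, T.indicator (fun b => ENNReal.ofReal (c b * F b n ω)) b) :=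
    measurable_eexpNeg.comp (Measurable.tsum fun b => (hmY b).comp (hFm b n))
  rw [lintegral_const_mul _ hmT, Params.detProb, eexpNeg_add]
  congr 1
  have hrow : iIndepFun (fun b => F b n) P :=
    hFi.precomp (g := fun b : ℕ => (b, n)) fun b b' h => (Prod.mk.inj h).1
  rw [lintegral_eexpNeg_tsum (fun b ω => T.indicator (fun b => ENNReal.ofReal (c b * F b n ω)) b)
    (fun b => T.indicator (fun b => ENNReal.ofReal (Real.log (1 + c b))) b)
    (hrow.comp _ hmY) fun b => (hmY b).comp (hFm b n)]
  · congr 1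
    rw [Params.interfExp]
    congr 1
    ext b
    by_cases hb : b ∈ T
    · rw [Set.indicator_of_mem hb, Set.indicator_of_mem (s := p.farSector i ‖z a‖)
        ⟨hb.2, ha.2.2 b hb.1 hb.2⟩]
      rfl
    -- The strict inequality defining `farSector` excludes `a` itself, so its indices are exactly
    -- the interferers.
    · rw [Set.indicator_of_notMem hb, Set.indicator_of_notMem]
      rintro ⟨h1, h2⟩
      refine hb ⟨?_, h1⟩
      rintro rfl
      exact lt_irrefl ‖z b‖ h2
  · intro b
    by_cases hb : b ∈ T
    · simp only [Set.indicator_of_mem hb]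
      have hcb : 0 ≤ c b := div_nonneg (mul_nonneg hp.Gam_pos.le hl0.le) (hTpos b hb).le
      rw [← lintegral_eexpNeg_expMeasure hcb, ← hFl b n,
        lintegral_map (f := fun y => eexpNeg (ENNReal.ofReal (c b * y)))
          (measurable_eexpNeg.comp (by fun_prop)) (hFm b n)]
    · simp [Set.indicator_of_notMem hb]

/-- Missing sector `i` in cycle `n` involves only the fadings of the stations of that sector in that
cycle. Sectors are disjoint, so distinct pairs `(i, n)` use disjoint groups of fadings. -/
lemma measure_no_success (hp : p.Valid)
    (hFm : ∀ i n, Measurable (F i n)) (hFl : ∀ i n, P.map (F i n) = expMeasure 1)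
    (hFi : iIndepFun (fun q : ℕ × ℕ => F q.1 q.2) P) {a : Fin p.M → ℕ}
    (ha : ∀ i, p.UniqueBest z i (a i)) (j : ℕ) :
    P {ω | ∀ n ∈ Finset.Icc 1 j, ¬ p.Success (fun b _ => z b) F n ω}
      = ∏ i, (1 - p.detProb i ‖z (a i)‖ z) ^ j := by
  set E : Fin p.M × ℕ → Set Ω := fun q => {ω | p.SectorDetected (fun b _ => z b) F q.2 q.1 ω}ᶜ
  have hset : {ω | ∀ n ∈ Finset.Icc 1 j, ¬ p.Success (fun b _ => z b) F n ω}
      = ⋂ q ∈ (Finset.univ ×ˢ Finset.Icc 1 j : Finset (Fin p.M × ℕ)), E q := by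
    ext ω
    simp only [Params.Success, E, Set.mem_iInter, Finset.mem_product, Finset.mem_univ, true_and,
      Set.mem_compl_iff, Set.mem_ofPred_eq, Prod.forall, not_exists]
    exact ⟨fun h i n hn => h n hn i, fun h n hn i => h i n hn⟩
  set S : Fin p.M × ℕ → Set (ℕ × ℕ) := fun q => {r | z r.1 ∈ p.sector q.1 ∧ r.2 = q.2}
  have hmeas : ∀ q, MeasurableSet[⨆ r ∈ S q, MeasurableSpace.comap (F r.1 r.2) inferInstance]
      (E q)ᶜ := by
    rintro ⟨i, n⟩
    have hr : ∀ b, z b ∈ p.sector i → Measurable[⨆ r ∈ S (i, n),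
        MeasurableSpace.comap (F r.1 r.2) inferInstance] (F b n) := fun b hb =>
      Measurable.mono (comap_measurable (F b n)) (le_iSup₂_of_le
        (f := fun (r : ℕ × ℕ) (_ : r ∈ S (i, n)) =>
          MeasurableSpace.comap (F r.1 r.2) inferInstance) (b, n) ⟨hb, rfl⟩ le_rfl) le_rfl
    have : (E (i, n))ᶜ = {ω | ENNReal.ofReal p.Gam *
        (p.interference (fun b _ => z b) F n i (a i) ω + ENNReal.ofReal (p.W / (p.Pb * p.M)))
          < ENNReal.ofReal (F (a i) n ω / p.pathLoss ‖z (a i)‖)} := by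
      ext ω
      simp only [E, compl_compl]
      exact (ha i).sectorDetected_iff hp n ω
    rw [this]
    refine measurableSet_lt ?_ ?_
    · refine Measurable.const_mul (Measurable.add_const ?_ _) _
      exact measurable_interference_aux _ i (a i) n fun b _ hb => hr b hb
    · exact ((hr _ (ha i).1).div_const _).ennreal_ofReal
  have hle : ∀ q : ℕ × ℕ, MeasurableSpace.comap (F q.1 q.2) inferInstance
    ≤ ‹MeasurableSpace Ω› := fun q => (hFm q.1 q.2).comap_le
  rw [hset, measure_biInter_of_disjoint_groups hle hFi.iIndep S ?_ _ _
    fun q _ => (@MeasurableSet.compl_iff _ _ (_)).1 (hmeas q)]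
  · rw [Finset.prod_product]
    refine Finset.prod_congr rfl fun i _ => ?_
    have hj : (1 - p.detProb i ‖z (a i)‖ z) ^ j
        = ∏ _n ∈ Finset.Icc 1 j, (1 - p.detProb i ‖z (a i)‖ z) := by simp
    rw [hj]
    refine Finset.prod_congr rfl fun n _ => ?_
    have hmE : MeasurableSet (E (i, n))ᶜ := (iSup₂_le fun r _ => hle r) _ (hmeas (i, n))
    rw [← compl_compl (E (i, n)), prob_compl_eq_one_sub hmE]
    congr 1
    simp only [E, compl_compl]
    exact (ha i).measure_sectorDetected hp hFm hFl hFi n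
  · rintro ⟨i, n⟩ ⟨i', n'⟩ hne
    rw [Set.disjoint_left]
    rintro r ⟨h1, h2⟩ ⟨h3, h4⟩
    have h5 : n = n' := h2.symm.trans h4
    have h6 : i ≠ i' := by rintro rfl; exact hne (by rw [h5])
    exact Set.disjoint_left.1 (hp.disjoint_sector h6) h1 h3

end Deterministic


/-! ### The counting measure of a configuration of points -/

/-- The counting measure of the configuration `z`. -/
noncomputable def pts (z : ℕ → ℂ) : Measure ℂ := Measure.sum fun b => Measure.dirac (z b)

lemma lintegral_pts (z : ℕ → ℂ) {g : ℂ → ℝ≥0∞} (hg : Measurable g) :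
    ∫⁻ w, g w ∂(pts z) = ∑' b, g (z b) := by
  rw [pts, lintegral_sum_measure]
  simp_rw [lintegral_dirac' _ hg]

lemma setLIntegral_pts (z : ℕ → ℂ) {g : ℂ → ℝ≥0∞} (hg : Measurable g) {A : Set ℂ}
    (hA : MeasurableSet A) : ∫⁻ w in A, g w ∂(pts z) = ∑' b, A.indicator g (z b) := by
  rw [← lintegral_indicator hA, lintegral_pts z (hg.indicator hA)]

lemma pts_apply {Ω : Type*} (x : ℕ → Ω → ℂ) {A : Set ℂ} (hA : MeasurableSet A) (ω : Ω) :
    pts (fun b => x b ω) A = ((count x A ω : ℕ∞) : ℝ≥0∞) := by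
  rw [← lintegral_indicator_one hA, lintegral_pts _ (measurable_one.indicator hA), count,
    ← ENNReal.tsum_set_one, tsum_subtype {i | x i ω ∈ A} fun _ => (1 : ℝ≥0∞)]
  rfl

namespace IsPoissonProcess

/-! ### Independence over disjoint regions -/

/-- The Borel subsets of `A` of finite area. -/
abbrev SubRegion (A : Set ℂ) : Type := {B : Set ℂ // MeasurableSet B ∧ B ⊆ A ∧ volume B ≠ ∞}

/-- The σ-algebra generated by the points in the region `A`. -/
@[reducible] noncomputable def region {Ω : Type*} (x : ℕ → Ω → ℂ) (A : Set ℂ) : MeasurableSpace Ω :=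
  ⨆ B : SubRegion A, MeasurableSpace.comap (fun ω => pts (fun b => x b ω) B.1) inferInstance

section Region

variable {Ω : Type*} {x : ℕ → Ω → ℂ}

lemma measurable_region_pts {A B : Set ℂ} (hB : MeasurableSet B) (hBA : B ⊆ A)
    (hB' : volume B ≠ ∞) : Measurable[region x A] fun ω => pts (fun b => x b ω) B :=
  Measurable.mono (comap_measurable _) (le_iSup
    (fun B : SubRegion A => MeasurableSpace.comap (fun ω => pts (fun b => x b ω) B.1)
      inferInstance) ⟨B, hB, hBA, hB'⟩) le_rfl

/-- The generators of `region` see only sets of finite area; exhausting the plane by balls recovers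
every Borel subset of `A`. -/
lemma measurable_region_restrict {A : Set ℂ} (hA : MeasurableSet A) :
    Measurable[region x A] fun ω => (pts fun b => x b ω).restrict A := by
  refine @Measure.measurable_of_measurable_coe _ _ _ (region x A) _ fun B hB => ?_
  have h1 : ∀ ω, ((pts fun b => x b ω).restrict A) B
      = ⨆ n : ℕ, pts (fun b => x b ω) (B ∩ A ∩ Metric.ball 0 n) := by
    intro ω
    rw [Measure.restrict_apply hB, ← Monotone.measure_iUnion, ← Set.inter_iUnion,
      Metric.iUnion_ball_nat, Set.inter_univ]
    intro m n hmn
    exact Set.inter_subset_inter_right _ (Metric.ball_subset_ball (by exact_mod_cast hmn))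
  simp_rw [h1]
  refine Measurable.iSup fun n => measurable_region_pts ((hB.inter hA).inter measurableSet_ball)
    (fun z hz => hz.1.2) ?_
  exact measure_ne_top_of_subset Set.inter_subset_right measure_ball_lt_top.ne

lemma measurable_region_lintegral {A : Set ℂ} (hA : MeasurableSet A) {g : ℂ → ℝ≥0∞}
    (hg : Measurable g) : Measurable[region x A] fun ω => ∫⁻ w in A, g w ∂(pts fun b => x b ω) :=
  (Measure.measurable_lintegral hg).comp (measurable_region_restrict hA)

end Region

end IsPoissonProcess

/-! ### Poisson counts: void probabilities, generating function, independence. -/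

section Poisson

variable {Ω : Type*} [MeasurableSpace Ω] {P : Measure Ω} {lam : ℝ} {x : ℕ → Ω → ℂ}

lemma measurable_pts (hx : ∀ i, Measurable (x i)) :
    Measurable fun ω => pts (fun b => x b ω) := by
  refine Measure.measurable_of_measurable_coe _ fun A hA => ?_
  have : (fun ω => pts (fun b => x b ω) A) = fun ω => ∑' b, A.indicator 1 (x b ω) := by
    ext ω
    rw [← lintegral_indicator_one hA, lintegral_pts _ (measurable_one.indicator hA)]
  rw [this]
  exact Measurable.tsum fun b => (measurable_one.indicator hA).comp (hx b)

lemma measurable_pts_apply (hx : ∀ i, Measurable (x i)) {A : Set ℂ} (hA : MeasurableSet A) :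
    Measurable fun ω => pts (fun b => x b ω) A :=
  (Measure.measurable_coe hA).comp (measurable_pts hx)

namespace IsPoissonProcess

/-- Mean number of points in `A`. -/
noncomputable def mean (lam : ℝ) (A : Set ℂ) : ℝ≥0 := (ENNReal.ofReal lam * volume A).toNNReal

/-- The push-forward along a map that is not a.e. measurable is the zero measure by convention,
whereas `law` makes it a Poisson law, of total mass 1. -/
lemma aemeasurable_count [IsProbabilityMeasure P] (h : IsPoissonProcess P lam x) {A : Set ℂ}
    (hA : MeasurableSet A) (hA' : volume A ≠ ∞) : AEMeasurable (count x A) P := by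
  by_contra hc
  have h1 := h.law A hA hA'
  rw [Measure.map_of_not_aemeasurable hc] at h1
  have h2 := congrArg (fun μ : Measure ℕ∞ => μ Set.univ) h1
  simp only [Measure.coe_zero, Pi.zero_apply] at h2
  rw [Measure.map_apply .of_discrete MeasurableSet.univ, Set.preimage_univ, measure_univ] at h2
  exact zero_ne_one h2

lemma lintegral_pts_apply [IsProbabilityMeasure P] (h : IsPoissonProcess P lam x) {A : Set ℂ}
    (hA : MeasurableSet A) (hA' : volume A ≠ ∞) (g : ℝ≥0∞ → ℝ≥0∞) :
    ∫⁻ ω, g (pts (fun b => x b ω) A) ∂P = ∫⁻ n : ℕ, g n ∂(poissonMeasure (mean lam A)) := by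
  simp_rw [pts_apply x hA]
  rw [← lintegral_map' (f := fun n : ℕ∞ => g (n : ℝ≥0∞)) (Measurable.of_discrete).aemeasurable
    (h.aemeasurable_count hA hA'), h.law A hA hA', lintegral_map .of_discrete .of_discrete]
  rfl

lemma measure_pts_apply_mem [IsProbabilityMeasure P] (h : IsPoissonProcess P lam x) {A : Set ℂ}
    (hA : MeasurableSet A) (hA' : volume A ≠ ∞) {T : Set ℝ≥0∞} (hT : MeasurableSet T) :
    P {ω | pts (fun b => x b ω) A ∈ T} =
      poissonMeasure (mean lam A) {n : ℕ | (n : ℝ≥0∞) ∈ T} := by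
  have h1 := h.lintegral_pts_apply hA hA' (T.indicator 1)
  have hm := measurable_pts_apply h.measurable hA
  have e1 : ∀ ω, T.indicator (1 : ℝ≥0∞ → ℝ≥0∞) (pts (fun b => x b ω) A)
      = {ω | pts (fun b => x b ω) A ∈ T}.indicator 1 ω := fun ω => rfl
  have e2 : ∀ n : ℕ, T.indicator (1 : ℝ≥0∞ → ℝ≥0∞) n
      = {n : ℕ | (n : ℝ≥0∞) ∈ T}.indicator 1 n := fun ω => rfl
  simp_rw [e1, e2] at h1
  have hs : MeasurableSet {ω | pts (fun b => x b ω) A ∈ T} := hm hT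
  rwa [lintegral_indicator_one hs, lintegral_indicator_one .of_discrete] at h1

lemma ae_pts_apply_lt_top [IsProbabilityMeasure P] (h : IsPoissonProcess P lam x) {A : Set ℂ}
    (hA : MeasurableSet A) (hA' : volume A ≠ ∞) : ∀ᵐ ω ∂P, pts (fun b => x b ω) A < ∞ := by
  rw [ae_iff]
  have := h.measure_pts_apply_mem hA hA' (T := {∞}) (measurableSet_singleton _)
  simpa using this

lemma measure_pts_apply_eq_zero [IsProbabilityMeasure P] (h : IsPoissonProcess P lam x) {A : Set ℂ}
    (hA : MeasurableSet A) (hA' : volume A ≠ ∞) :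
    P {ω | pts (fun b => x b ω) A = 0} = ENNReal.ofReal (Real.exp (-(mean lam A))) := by
  have := h.measure_pts_apply_mem hA hA' (T := {0}) (measurableSet_singleton _)
  simp only [Set.mem_singleton_iff, Nat.cast_eq_zero, Set.ofPred_eq_eq_singleton] at this
  rw [this, poissonMeasure_singleton]
  simp

/-- `1 - exp (-μ) * (1 + μ) ≤ μ ^ 2` follows from `exp (-μ) ≥ 1 - μ`. The quadratic order is what
rules out ties between distances as cells shrink. -/
lemma measure_two_le_pts_apply [IsProbabilityMeasure P] (h : IsPoissonProcess P lam x) {A : Set ℂ}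
    (hA : MeasurableSet A) (hA' : volume A ≠ ∞) :
    P {ω | 2 ≤ pts (fun b => x b ω) A} ≤ ENNReal.ofReal ((mean lam A : ℝ) ^ 2) := by
  have := h.measure_pts_apply_mem hA hA' (T := Set.Ici 2) measurableSet_Ici
  simp only [Set.mem_Ici] at this
  rw [this]
  set μ := mean lam A
  have h2 : {n : ℕ | (2 : ℝ≥0∞) ≤ n} = ({0, 1} : Set ℕ)ᶜ := by
    ext n
    simp only [Set.mem_ofPred_eq, Set.mem_compl_iff, Set.mem_insert_iff, Set.mem_singleton_iff]
    rw [show (2 : ℝ≥0∞) = ((2 : ℕ) : ℝ≥0∞) by simp, Nat.cast_le]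
    omega
  have h3 : poissonMeasure μ {0, 1}
      = ENNReal.ofReal (Real.exp (-μ) + Real.exp (-μ) * μ) := by
    rw [← Set.singleton_union, measure_union (by simp) (measurableSet_singleton _),
      poissonMeasure_singleton, poissonMeasure_singleton, ← ENNReal.ofReal_add (by positivity)
        (by positivity)]
    simp
  rw [h2, prob_compl_eq_one_sub .of_discrete, h3, ← ENNReal.ofReal_one,
    ← ENNReal.ofReal_sub _ (by positivity)]
  refine ENNReal.ofReal_le_ofReal ?_
  have := Real.add_one_le_exp (-(μ : ℝ))
  nlinarith [μ.coe_nonneg]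

/-- The Poisson generating function `exp (-μ (1 - t))` at `t = exp (-s)`, including `s = ∞`, that is
`t = 0`. -/
lemma lintegral_eexpNeg_mul_pts [IsProbabilityMeasure P] (h : IsPoissonProcess P lam x)
    {A : Set ℂ} (hA : MeasurableSet A) (hA' : volume A ≠ ∞) (s : ℝ≥0∞) :
    ∫⁻ ω, eexpNeg (s * pts (fun b => x b ω) A) ∂P
      = eexpNeg (ENNReal.ofReal lam * volume A * (1 - eexpNeg s)) := by
  rw [h.lintegral_pts_apply hA hA' fun y => eexpNeg (s * y)]
  simp_rw [mul_comm s, eexpNeg_nat_mul]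
  have hμ : ENNReal.ofReal lam * volume A = (mean lam A : ℝ≥0∞) :=
    (ENNReal.coe_toNNReal (ENNReal.mul_ne_top ENNReal.ofReal_ne_top hA')).symm
  rw [hμ]
  set μ := mean lam A
  set t : ℝ := expNeg s with ht
  have ht0 : 0 ≤ t := expNeg_nonneg s
  have ht1 : t ≤ 1 := expNeg_le_one s
  have e1 : eexpNeg s = ENNReal.ofReal t := rfl
  rw [e1, ← ENNReal.ofReal_one, ← ENNReal.ofReal_sub _ ht0, ← ENNReal.ofReal_coe_nnreal,
    ← ENNReal.ofReal_mul (by positivity), eexpNeg_ofReal (by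
      have : 0 ≤ 1 - t := by linarith
      positivity)]
  rw [poissonMeasure, lintegral_sum_measure]
  simp_rw [lintegral_smul_measure, lintegral_dirac, smul_eq_mul, ← ENNReal.ofReal_pow ht0]
  have hs : HasSum (fun n : ℕ => Real.exp (-μ) * ((μ * t) ^ n / n.factorial))
      (Real.exp (-μ) * Real.exp (μ * t)) := by
    rw [Real.exp_eq_exp_ℝ]
    exact (NormedSpace.expSeries_div_hasSum_exp (μ * t : ℝ)).mul_left _
  have e2 : ∀ n : ℕ, ENNReal.ofReal (Real.exp (-μ) * μ ^ n / n.factorial) * ENNReal.ofReal (t ^ n)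
      = ENNReal.ofReal (Real.exp (-μ) * ((μ * t) ^ n / n.factorial)) := by
    intro n
    rw [← ENNReal.ofReal_mul (by positivity), mul_pow]
    congr 1; ring
  simp_rw [e2]
  rw [← ENNReal.ofReal_tsum_of_nonneg (fun n => by positivity) hs.summable, hs.tsum_eq,
    ← Real.exp_add]
  congr 2; ring

lemma iIndepFun_pts (h : IsPoissonProcess P lam x) {ι : Type*} [Finite ι] (A : ι → Set ℂ)
    (hA : ∀ k, MeasurableSet (A k)) (hA' : ∀ k, volume (A k) ≠ ∞)
    (hd : Pairwise fun k l => Disjoint (A k) (A l)) :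
    iIndepFun (fun k ω => pts (fun b => x b ω) (A k)) P := by
  obtain ⟨n, ⟨e⟩⟩ := Finite.exists_equiv_fin ι
  have h1 := h.indep n (fun k => A (e.symm k)) (fun k => hA _) (fun k => hA' _)
    fun k l hkl => hd (e.symm.injective.ne hkl)
  have h2 : iIndepFun (fun k ω => pts (fun b => x b ω) (A (e.symm k))) P := by
    convert! h1.comp (fun _ (n : ℕ∞) => (n : ℝ≥0∞)) fun _ => .of_discrete using 2 with k
    ext ω
    exact pts_apply x (hA _) ω
  exact h2.of_precomp (g := e.symm) e.symm.surjective

lemma region_le (h : IsPoissonProcess P lam x) (A : Set ℂ) :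
    region x A ≤ ‹MeasurableSpace Ω› :=
  iSup_le fun B => (measurable_pts_apply h.measurable B.2.1).comap_le

/-- Independence is assumed only for counts in disjoint sets, while a region generates events
involving overlapping ones. It suffices to treat events depending on finitely many subsets of each
`A k`. Cut these subsets into atoms: the atoms are disjoint, also across regions, so their counts
are independent, and each original count is a sum over atoms of its own region. -/
lemma iIndep_region [IsProbabilityMeasure P] (h : IsPoissonProcess P lam x) {ι : Type*}
    (A : ι → Set ℂ) (hd : Pairwise fun k l => Disjoint (A k) (A l)) :
    iIndep (fun k => region x (A k)) P := by
  classical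
  set m : ∀ k, SubRegion (A k) → MeasurableSpace Ω := fun k B =>
    MeasurableSpace.comap (fun ω => pts (fun b => x b ω) B.1) inferInstance with hm
  refine iIndepSets.iIndep (fun k => h.region_le _)
    (fun k => piiUnionInter (fun B => {s | MeasurableSet[m k B] s}) Set.univ)
    (fun k => isPiSystem_piiUnionInter _ (fun B => @MeasurableSpace.isPiSystem_measurableSet _ (m k B)) _)
    (fun k => ?_) ?_
  · rw [generateFrom_piiUnionInter_measurableSet (m k)]
    simp [hm]
  rw [iIndepSets_iff]
  intro s f hf
  choose! t _ E hE hfE using hf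
  -- the atoms of the finite family of regions
  set C : (k : ι) → Finset (SubRegion (A k)) → Set ℂ := fun k u =>
    {z | ∀ B ∈ t k, z ∈ B.1 ↔ B ∈ u} with hC
  have hCm : ∀ k u, MeasurableSet (C k u) := by
    intro k u
    have : C k u = ⋂ B ∈ t k, {z | z ∈ B.1 ↔ B ∈ u} := by ext z; simp [hC]
    rw [this]
    refine Finset.measurableSet_biInter _ fun B _ => ?_
    by_cases hBu : B ∈ u
    · simpa [hBu] using B.2.1
    · simp only [hBu, iff_false]
      exact B.2.1.compl
  -- The empty label is removed: its atom is the complement of all the chosen subsets, which may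
  -- have infinite area and overlap the other regions.
  set ι' : Type _ := Σ k : s, {u // u ∈ (t k.1).powerset.erase ∅}
  set D : ι' → Set ℂ := fun q => C q.1.1 q.2.1 with hD
  have hsub : ∀ q : ι', ∃ B : SubRegion (A q.1.1), D q ⊆ B.1 := by
    rintro ⟨k, u, hu⟩
    rw [Finset.mem_erase, Finset.mem_powerset] at hu
    obtain ⟨B, hB⟩ := Finset.nonempty_iff_ne_empty.2 hu.1
    exact ⟨B, fun z hz => (hz B (hu.2 hB)).2 hB⟩
  have hDd : Pairwise fun q r => Disjoint (D q) (D r) := by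
    intro q r hqr
    rw [Set.disjoint_left]
    intro z hzq hzr
    obtain ⟨B, hB⟩ := hsub q
    obtain ⟨B', hB'⟩ := hsub r
    have hkk : q.1 = r.1 := by
      by_contra hne
      exact Set.disjoint_left.1 (hd fun h => hne (Subtype.ext h)) (B.2.2.1 (hB hzq))
        (B'.2.2.1 (hB' hzr))
    obtain ⟨k, u, hu⟩ := q
    obtain ⟨k', u', hu'⟩ := r
    obtain rfl : k = k' := hkk
    apply hqr
    congr 2
    rw [Finset.mem_erase, Finset.mem_powerset] at hu hu'
    ext B
    constructor
    · intro hBu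
      exact (hzr B (hu.2 hBu)).1 ((hzq B (hu.2 hBu)).2 hBu)
    · intro hBu
      exact (hzq B (hu'.2 hBu)).1 ((hzr B (hu'.2 hBu)).2 hBu)
  have hind := h.iIndepFun_pts D (fun q => hCm _ _) (fun q => by
    obtain ⟨B, hB⟩ := hsub q
    exact measure_ne_top_of_subset hB B.2.2.2) hDd
  set m' : ι' → MeasurableSpace Ω := fun q =>
    MeasurableSpace.comap (fun ω => pts (fun b => x b ω) (D q)) inferInstance with hm'
  have hle : ∀ q, m' q ≤ ‹MeasurableSpace Ω› := fun q =>
    (measurable_pts_apply h.measurable (hCm _ _)).comap_le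
  have key := measure_biInter_of_disjoint_groups (m := m') hle hind.iIndep
    (fun k : s => {q : ι' | q.1 = k}) ?_ Finset.univ (fun k => f k.1) ?_
  · have e1 : (⋂ k ∈ s, f k) = ⋂ k ∈ (Finset.univ : Finset s), f k.1 := by
      ext ω; simp
    rw [e1, key]
    exact Finset.prod_coe_sort s fun k => P (f k)
  · intro k l hkl
    rw [Set.disjoint_left]
    intro q (hq : q.1 = k) (hq' : q.1 = l)
    exact hkl (hq.symm.trans hq')
  · intro k _
    rw [hfE k.1 k.2]
    refine Finset.measurableSet_biInter _ fun B hB => ?_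
    have h1 : Measurable[⨆ q ∈ {q : ι' | q.1 = k}, m' q]
        fun ω => pts (fun b => x b ω) B.1 := by
      have h2 : ∀ ω, pts (fun b => x b ω) B.1
          = ∑ u : {u // u ∈ (t k.1).powerset.erase ∅},
            if B ∈ u.1 then pts (fun b => x b ω) (D ⟨k, u⟩) else 0 := by
        intro ω
        rw [← Finset.sum_filter, ← measure_biUnion_finset]
        · congr 1
          ext z
          simp only [Set.mem_iUnion, Finset.mem_filter, Finset.mem_univ, true_and]
          constructor
          · intro hz
            have hBu : B ∈ (t k.1).filter fun B => z ∈ B.1 := by simp [hB, hz]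
            refine ⟨⟨(t k.1).filter fun B => z ∈ B.1, ?_⟩, hBu, ?_⟩
            · rw [Finset.mem_erase, Finset.mem_powerset]
              exact ⟨Finset.ne_empty_of_mem hBu, Finset.filter_subset _ _⟩
            · intro B' hB'
              simp [hB']
          · rintro ⟨u, hBu, hz⟩
            exact (hz B hB).2 hBu
        · intro u _ u' _ huu
          exact hDd fun h => huu (eq_of_heq (Sigma.mk.inj h).2)
        · exact fun u _ => hCm _ _
      simp_rw [h2]
      refine Finset.measurable_fun_sum _ fun u _ => ?_
      by_cases hBu : B ∈ u.1
      · simp only [hBu, if_true]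
        exact Measurable.mono (comap_measurable _) (le_iSup₂_of_le
          (f := fun (q : ι') (_ : q ∈ {q : ι' | q.1 = k}) => m' q) ⟨k, u⟩ rfl le_rfl) le_rfl
      · simp only [hBu, if_false]
        exact measurable_const
    exact h1.comap_le _ (hE k.1 k.2 B hB)

end IsPoissonProcess

end Poisson


/-! ### The probability generating functional -/

lemma measurable_one_sub_eexpNeg : Measurable fun a : ℝ≥0∞ => 1 - eexpNeg a :=
  measurable_const.sub measurable_eexpNeg

lemma eexpNeg_antitone : Antitone eexpNeg := by
  intro a b hab
  obtain ⟨c, rfl⟩ := exists_add_of_le hab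
  rw [eexpNeg_add]
  exact mul_le_of_le_one_right' (eexpNeg_le_one c)

namespace IsPoissonProcess

variable {Ω : Type*} [MeasurableSpace Ω] {P : Measure Ω} [IsProbabilityMeasure P] {lam : ℝ}
  {x : ℕ → Ω → ℂ}

/-- The level sets of the nonzero values are disjoint and of finite area, so their counts are
independent Poisson variables and the exponential factors. The value 0 is dropped: its level set may
have infinite area but contributes nothing to either side. -/
lemma lintegral_eexpNeg_simpleFunc (h : IsPoissonProcess P lam x) (φ : SimpleFunc ℂ ℝ≥0∞)
    (hφ : volume (Function.support φ) ≠ ∞) :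
    ∫⁻ ω, eexpNeg (∫⁻ w, φ w ∂(pts fun b => x b ω)) ∂P
      = eexpNeg (ENNReal.ofReal lam * ∫⁻ w, (1 - eexpNeg (φ w))) := by
  classical
  set R := φ.range.erase 0 with hR
  have hfin : ∀ y : R, volume (φ ⁻¹' {y.1}) ≠ ∞ := by
    intro y
    refine measure_ne_top_of_subset ?_ hφ
    intro w hw
    have : φ w = y.1 := hw
    rw [Function.mem_support, this]
    exact (Finset.mem_erase.1 y.2).1
  have hd : Pairwise fun y y' : R => Disjoint (φ ⁻¹' {y.1}) (φ ⁻¹' {y'.1}) := by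
    intro y y' hyy
    exact Disjoint.preimage _ (Set.disjoint_singleton.2 fun h => hyy (Subtype.ext h))
  have e1 : ∀ μ : Measure ℂ, ∫⁻ w, φ w ∂μ = ∑ y : R, y.1 * μ (φ ⁻¹' {y.1}) := by
    intro μ
    rw [SimpleFunc.lintegral_eq_lintegral, SimpleFunc.lintegral,
      Finset.sum_coe_sort R fun y => y * μ (φ ⁻¹' {y})]
    exact (Finset.sum_erase _ (by simp)).symm
  have e2 : ∫⁻ w, (1 - eexpNeg (φ w)) = ∑ y : R, (1 - eexpNeg y.1) * volume (φ ⁻¹' {y.1}) := by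
    have : ∫⁻ w, (1 - eexpNeg (φ w)) = ∫⁻ w, (φ.map fun y => 1 - eexpNeg y) w := rfl
    rw [this, SimpleFunc.lintegral_eq_lintegral, SimpleFunc.map_lintegral,
      Finset.sum_coe_sort R fun y => (1 - eexpNeg y) * volume (φ ⁻¹' {y})]
    exact (Finset.sum_erase _ (by simp)).symm
  have hind := h.iIndepFun_pts (fun y : R => φ ⁻¹' {y.1}) (fun y => φ.measurableSet_preimage _)
    hfin hd
  have hm : ∀ y : R, Measurable fun t : ℝ≥0∞ => eexpNeg (y.1 * t) := fun y =>
    measurable_eexpNeg.comp (measurable_const_mul _)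
  simp_rw [e1, eexpNeg_sum]
  rw [lintegral_prod_eq_prod_lintegral_of_indepFun _
    (fun (y : R) ω => eexpNeg (y.1 * pts (fun b => x b ω) (φ ⁻¹' {y.1})))
    (hind.comp (fun (y : R) t => eexpNeg (y.1 * t)) hm)
    fun y => (hm y).comp (measurable_pts_apply h.measurable (φ.measurableSet_preimage _)),
    e2, Finset.mul_sum, eexpNeg_sum]
  refine Finset.prod_congr rfl fun y _ => ?_
  rw [h.lintegral_eexpNeg_mul_pts (φ.measurableSet_preimage _) (hfin y)]
  congr 1
  ring

/-- The probability generating functional of a Poisson process. -/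
lemma lintegral_eexpNeg (h : IsPoissonProcess P lam x) {g : ℂ → ℝ≥0∞} (hg : Measurable g) :
    ∫⁻ ω, eexpNeg (∫⁻ w, g w ∂(pts fun b => x b ω)) ∂P
      = eexpNeg (ENNReal.ofReal lam * ∫⁻ w, (1 - eexpNeg (g w))) := by
  -- Restricting to growing balls gives supports of finite area without spoiling the monotone
  -- convergence to `g`.
  set φ : ℕ → SimpleFunc ℂ ℝ≥0∞ := fun n =>
    (SimpleFunc.eapprox g n).restrict (Metric.ball 0 n) with hφ
  have hφv : ∀ n w, φ n w = (Metric.ball (0 : ℂ) n).indicator (SimpleFunc.eapprox g n) w :=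
    fun n w => SimpleFunc.restrict_apply _ measurableSet_ball _
  have hmono : ∀ w, Monotone fun n => φ n w := by
    intro w m n hmn
    simp only [hφv]
    refine (Set.indicator_le_indicator_of_subset
      (Metric.ball_subset_ball (Nat.cast_le.2 hmn)) (fun _ => bot_le) w).trans ?_
    exact Set.indicator_le_indicator (SimpleFunc.monotone_eapprox g hmn w)
  have hlim : ∀ w, Tendsto (fun n => φ n w) atTop (𝓝 (g w)) := by
    intro w
    have h1 : Tendsto (fun n => SimpleFunc.eapprox g n w) atTop (𝓝 (g w)) :=
      SimpleFunc.tendsto_eapprox hg w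
    refine h1.congr' ?_
    obtain ⟨n₀, hn₀⟩ := exists_nat_gt ‖w‖
    filter_upwards [eventually_ge_atTop n₀] with n hn
    rw [hφv, Set.indicator_of_mem]
    rw [mem_ball_zero_iff]
    exact hn₀.trans_le (by exact_mod_cast hn)
  have hfin : ∀ n, volume (Function.support (φ n)) ≠ ∞ := by
    intro n
    refine ((measure_mono (t := Metric.ball (0 : ℂ) n) ?_).trans_lt measure_ball_lt_top).ne
    intro w hw
    by_contra hc
    exact hw (by rw [hφv, Set.indicator_of_notMem hc])
  have hint : ∀ μ : Measure ℂ, Tendsto (fun n => ∫⁻ w, φ n w ∂μ) atTop (𝓝 (∫⁻ w, g w ∂μ)) :=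
    fun μ => lintegral_tendsto_of_tendsto_of_monotone (fun n => (φ n).measurable.aemeasurable)
      (ae_of_all _ hmono) (ae_of_all _ hlim)
  have hL : Tendsto (fun n => ∫⁻ ω, eexpNeg (∫⁻ w, φ n w ∂(pts fun b => x b ω)) ∂P) atTop
      (𝓝 (∫⁻ ω, eexpNeg (∫⁻ w, g w ∂(pts fun b => x b ω)) ∂P)) := by
    refine tendsto_lintegral_of_dominated_convergence (fun _ => 1) (fun n => ?_)
      (fun n => ae_of_all _ fun ω => eexpNeg_le_one _) (by simp)
      (ae_of_all _ fun ω => (continuous_eexpNeg.tendsto _).comp (hint _))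
    exact measurable_eexpNeg.comp
      ((Measure.measurable_lintegral (φ n).measurable).comp (measurable_pts h.measurable))
  have hI : Tendsto (fun n => ∫⁻ w, (1 - eexpNeg (φ n w))) atTop
      (𝓝 (∫⁻ w, (1 - eexpNeg (g w)))) := by
    refine lintegral_tendsto_of_tendsto_of_monotone
      (fun n => (measurable_one_sub_eexpNeg.comp (φ n).measurable).aemeasurable)
      (ae_of_all _ fun w m n hmn => tsub_le_tsub_left (eexpNeg_antitone (hmono w hmn)) _)
      (ae_of_all _ fun w => ?_)
    exact ENNReal.Tendsto.sub tendsto_const_nhds ((continuous_eexpNeg.tendsto _).comp (hlim w))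
      (Or.inl ENNReal.one_ne_top)
  have hR : Tendsto (fun n => eexpNeg (ENNReal.ofReal lam * ∫⁻ w, (1 - eexpNeg (φ n w)))) atTop
      (𝓝 (eexpNeg (ENNReal.ofReal lam * ∫⁻ w, (1 - eexpNeg (g w))))) :=
    (continuous_eexpNeg.tendsto _).comp
      (ENNReal.Tendsto.const_mul hI (Or.inr ENNReal.ofReal_ne_top))
  simp_rw [fun n => h.lintegral_eexpNeg_simpleFunc (φ n) (hfin n)] at hL
  exact tendsto_nhds_unique hL hR

end IsPoissonProcess

/-! ### Polar coordinates in a sector -/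

/-- Polar coordinates use angles in `(-π, π)`, sectors use `[0, 2π)`. The part of `[a, b)` beyond
`π` is translated by `-2π`, and at most the single angle `π` is lost. -/
lemma volume_angles {a b : ℝ} (ha : 0 ≤ a) (hb : b ≤ 2 * Real.pi) :
    volume ({θ : ℝ | toIcoMod Real.two_pi_pos 0 θ ∈ Set.Ico a b} ∩ Set.Ioo (-Real.pi) Real.pi)
      = ENNReal.ofReal (b - a) := by
  have hpi := Real.pi_pos
  have hpos : ∀ θ ∈ Set.Ioo (-Real.pi) Real.pi, 0 ≤ θ → toIcoMod Real.two_pi_pos 0 θ = θ := by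
    intro θ hθ h0
    rw [toIcoMod_eq_self]
    exact ⟨h0, by linarith [hθ.2]⟩
  have hneg : ∀ θ ∈ Set.Ioo (-Real.pi) Real.pi, θ < 0 →
      toIcoMod Real.two_pi_pos 0 θ = θ + 2 * Real.pi := by
    intro θ hθ h0
    rw [← toIcoMod_add_right, toIcoMod_eq_self]
    exact ⟨by linarith [hθ.1], by linarith⟩
  have hset : {θ : ℝ | toIcoMod Real.two_pi_pos 0 θ ∈ Set.Ico a b} ∩ Set.Ioo (-Real.pi) Real.pi
      = (Set.Ico a b ∩ Set.Iio Real.pi) ∪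
        (fun θ => θ + 2 * Real.pi) ⁻¹' (Set.Ico a b ∩ Set.Ioi Real.pi) := by
    ext θ
    simp only [Set.mem_inter_iff, Set.mem_ofPred_eq, Set.mem_union, Set.mem_preimage,
      Set.mem_Iio, Set.mem_Ioi]
    constructor
    · rintro ⟨h1, h2⟩
      rcases le_or_gt 0 θ with h0 | h0
      · rw [hpos θ h2 h0] at h1
        exact Or.inl ⟨h1, h2.2⟩
      · rw [hneg θ h2 h0] at h1
        exact Or.inr ⟨h1, by linarith [h2.1]⟩
    · rintro (⟨h1, h2⟩ | ⟨h1, h2⟩)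
      · have h3 : θ ∈ Set.Ioo (-Real.pi) Real.pi := ⟨by linarith [h1.1], h2⟩
        rw [hpos θ h3 (ha.trans h1.1)]
        exact ⟨h1, h3⟩
      · have h4 : θ < 0 := by linarith [h1.2]
        have h3 : θ ∈ Set.Ioo (-Real.pi) Real.pi := ⟨by linarith, by linarith⟩
        rw [hneg θ h3 h4]
        exact ⟨h1, h3⟩
  have hdisj : Disjoint (Set.Ico a b ∩ Set.Iio Real.pi)
      ((fun θ => θ + 2 * Real.pi) ⁻¹' (Set.Ico a b ∩ Set.Ioi Real.pi)) := by
    rw [Set.disjoint_left]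
    rintro θ ⟨h1, h2⟩ ⟨h3, h4⟩
    linarith [h1.1, h3.2]
  rw [hset, measure_union hdisj ((measurable_add_const _)
    (measurableSet_Ico.inter measurableSet_Ioi)), measure_preimage_add_right]
  have h5 : volume (Set.Ico a b ∩ Set.Ioi Real.pi) = volume (Set.Ico a b \ Set.Iio Real.pi) := by
    refine measure_congr ?_
    rw [Set.sdiff_eq, Set.compl_Iio]
    exact (ae_eq_refl _).inter Ioi_ae_eq_Ici
  rw [h5, measure_inter_add_sdiff _ measurableSet_Iio, Real.volume_Ico]

lemma lintegral_sector {p : Params} (hp : p.Valid) (i : Fin p.M) {g : ℝ → ℝ≥0∞}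
    (hg : Measurable g) :
    ∫⁻ w in p.sector i, g ‖w‖
      = ENNReal.ofReal (2 * Real.pi / p.M) *
        ∫⁻ t in Set.Ioi (0 : ℝ), ENNReal.ofReal t * g t := by
  have hM : (0 : ℝ) < p.M := by exact_mod_cast hp.M_pos
  have hiM : (i : ℝ) + 1 ≤ p.M := by exact_mod_cast i.2
  have hpi := Real.pi_pos
  set a := 2 * Real.pi * (i : ℝ) / p.M with ha
  set b := 2 * Real.pi * ((i : ℝ) + 1) / p.M with hb
  set S : Set ℝ := {θ : ℝ | toIcoMod Real.two_pi_pos 0 θ ∈ Set.Ico a b} with hS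
  have hSm : MeasurableSet S := by
    have : Measurable (toIcoMod Real.two_pi_pos 0 : ℝ → ℝ) := by
      have : (toIcoMod Real.two_pi_pos 0 : ℝ → ℝ)
          = fun θ => θ - (⌊θ / (2 * Real.pi)⌋ : ℝ) * (2 * Real.pi) := by
        ext θ
        rw [toIcoMod, toIcoDiv_eq_floor]
        simp
      rw [this]
      fun_prop
    exact this measurableSet_Ico
  rw [← lintegral_indicator (p.measurableSet_sector i),
    ← Complex.lintegral_comp_polarCoord_symm]
  have hT : (polarCoord.target : Set (ℝ × ℝ)) = Set.Ioi 0 ×ˢ Set.Ioo (-Real.pi) Real.pi := rfl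
  have hcongr : ∫⁻ q in polarCoord.target, ENNReal.ofReal q.1 •
        (p.sector i).indicator (fun w => g ‖w‖) (Complex.polarCoord.symm q)
      = ∫⁻ q in Set.Ioi (0 : ℝ) ×ˢ Set.Ioo (-Real.pi) Real.pi,
        (ENNReal.ofReal q.1 * g q.1) * S.indicator 1 q.2 := by
    rw [hT]
    refine setLIntegral_congr_fun (measurableSet_Ioi.prod measurableSet_Ioo) ?_
    rintro ⟨t, θ⟩ ⟨ht, hθ⟩
    have ht : 0 < t := ht
    have hn : ‖Complex.polarCoord.symm (t, θ)‖ = t := by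
      rw [Complex.norm_polarCoord_symm, abs_of_pos ht]
    have harg : angle (Complex.polarCoord.symm (t, θ)) = toIcoMod Real.two_pi_pos 0 θ := by
      rw [angle, Complex.polarCoord_symm_apply]
      simp only [Complex.ofReal_cos, Complex.ofReal_sin]
      rw [Complex.arg_mul_cos_add_sin_mul_I ht ⟨hθ.1, hθ.2.le⟩]
    simp only [smul_eq_mul]
    have hmem : Complex.polarCoord.symm (t, θ) ∈ p.sector i ↔ θ ∈ S := by
      change angle _ ∈ Set.Ico a b ↔ _
      rw [harg]
      rfl
    by_cases h : θ ∈ S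
    · rw [Set.indicator_of_mem (hmem.2 h), Set.indicator_of_mem h, hn]
      simp
    · rw [Set.indicator_of_notMem (fun hc => h (hmem.1 hc)), Set.indicator_of_notMem h]
      simp
  rw [hcongr, Measure.volume_eq_prod, ← Measure.prod_restrict,
    lintegral_prod_mul (f := fun t => ENNReal.ofReal t * g t)
      (ENNReal.measurable_ofReal.mul hg).aemeasurable
      (measurable_one.indicator hSm).aemeasurable, mul_comm]
  congr 1
  rw [lintegral_indicator_one hSm, Measure.restrict_apply hSm, volume_angles (by positivity)]
  · congr 1
    rw [ha, hb]; ring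
  · rw [hb, div_le_iff₀ hM]; gcongr


/-! ### The nearest base station of a sector -/

lemma volume_sector_inter_ball {p : Params} (hp : p.Valid) (i : Fin p.M) {t : ℝ} (ht : 0 ≤ t) :
    volume (p.sector i ∩ Metric.ball 0 t) = ENNReal.ofReal (Real.pi * t ^ 2 / p.M) := by
  have hM : (0 : ℝ) < p.M := by exact_mod_cast hp.M_pos
  have h1 := lintegral_sector hp i (g := (Set.Iio t).indicator 1)
    (measurable_one.indicator measurableSet_Iio)
  have h2 : ∫⁻ w in p.sector i, (Set.Iio t).indicator 1 ‖w‖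
      = volume (p.sector i ∩ Metric.ball 0 t) := by
    have : ∀ w : ℂ, (Set.Iio t).indicator (1 : ℝ → ℝ≥0∞) ‖w‖
        = (Metric.ball (0 : ℂ) t).indicator (1 : ℂ → ℝ≥0∞) w := by
      intro w
      have : Metric.ball (0 : ℂ) t = norm ⁻¹' Set.Iio t := by ext; simp
      rw [this]
      rfl
    simp_rw [this]
    rw [lintegral_indicator_one measurableSet_ball, Measure.restrict_apply measurableSet_ball,
      Set.inter_comm]
  have h3 : ∫⁻ s in Set.Ioi (0 : ℝ), ENNReal.ofReal s * (Set.Iio t).indicator 1 s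
      = ENNReal.ofReal (t ^ 2 / 2) := by
    have e1 : ∀ s : ℝ, ENNReal.ofReal s * (Set.Iio t).indicator 1 s
        = (Set.Iio t).indicator (fun s => ENNReal.ofReal s) s := by
      intro s
      simp [Set.indicator_apply]
    simp_rw [e1]
    rw [lintegral_indicator measurableSet_Iio, Measure.restrict_restrict measurableSet_Iio,
      Set.inter_comm, Set.Ioi_inter_Iio, setLIntegral_congr Ioo_ae_eq_Ioc,
      ← ofReal_integral_eq_lintegral_ofReal, ← intervalIntegral.integral_of_le ht, integral_id]
    · simp
    · exact continuous_id.integrableOn_Ioc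
    · exact (ae_restrict_iff' measurableSet_Ioc).2 (ae_of_all _ fun s hs => hs.1.le)
  rw [← h2, h1, h3, ← ENNReal.ofReal_mul (by positivity)]
  congr 1
  ring

open Classical in
/-- Distance from the origin to the nearest point of `z` in sector `i`. -/
noncomputable def Params.secRad (p : Params) (i : Fin p.M) (z : ℕ → ℂ) : ℝ :=
  (⨅ b, if z b ∈ p.sector i then ENNReal.ofReal ‖z b‖ else ∞).toReal

lemma Params.measurable_secRad (p : Params) (i : Fin p.M) : Measurable (p.secRad i) := by
  refine Measurable.ennreal_toReal (Measurable.iInf fun b => ?_)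
  exact Measurable.ite (measurable_pi_apply b (p.measurableSet_sector i))
    (measurable_pi_apply b).norm.ennreal_ofReal measurable_const

lemma Params.UniqueBest.norm_le {p : Params} {z : ℕ → ℂ} {i : Fin p.M} {a : ℕ}
    (ha : p.UniqueBest z i a) {b : ℕ} (hb : z b ∈ p.sector i) : ‖z a‖ ≤ ‖z b‖ := by
  by_cases hba : b = a
  · rw [hba]
  · exact (ha.2.2 b hba hb).le

lemma Params.UniqueBest.secRad_eq {p : Params} {z : ℕ → ℂ} {i : Fin p.M} {a : ℕ}
    (ha : p.UniqueBest z i a) : p.secRad i z = ‖z a‖ := by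
  rw [Params.secRad, ← ENNReal.toReal_ofReal (norm_nonneg (z a))]
  congr 1
  refine le_antisymm (iInf_le_of_le a (by rw [if_pos ha.1])) (le_iInf fun b => ?_)
  split_ifs with hb
  · exact ENNReal.ofReal_le_ofReal (ha.norm_le hb)
  · exact le_top

lemma pts_eq_zero_iff (z : ℕ → ℂ) {A : Set ℂ} (hA : MeasurableSet A) :
    pts z A = 0 ↔ ∀ b, z b ∉ A := by
  rw [← lintegral_indicator_one hA, lintegral_pts z (measurable_one.indicator hA),
    ENNReal.tsum_eq_zero]
  simp

/-- Expresses the distance through void events of open sector disks, whose probabilities and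
σ-algebras are under control. Openness of the disk is why the inequality is not strict. -/
lemma Params.UniqueBest.pts_ball_eq_zero_iff {p : Params} {z : ℕ → ℂ} {i : Fin p.M} {a : ℕ}
    (ha : p.UniqueBest z i a) (t : ℝ) :
    pts z (p.sector i ∩ Metric.ball 0 t) = 0 ↔ t ≤ p.secRad i z := by
  rw [pts_eq_zero_iff z ((p.measurableSet_sector i).inter measurableSet_ball), ha.secRad_eq]
  constructor
  · intro h
    by_contra hc
    exact h a ⟨ha.1, by simpa using hc⟩
  · rintro h b ⟨hb1, hb2⟩
    have := ha.norm_le hb1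
    rw [mem_ball_zero_iff] at hb2
    linarith

lemma nearestDist_eq {Ω : Type*} {p : Params} (hp : p.Valid) {x : ℕ → Ω → ℂ} {ω : Ω}
    {a : Fin p.M → ℕ} (ha : ∀ i, p.UniqueBest (fun b => x b ω) i (a i)) :
    nearestDist x ω = ⨅ i, p.secRad i (fun b => x b ω) := by
  have hne : Nonempty (Fin p.M) := ⟨⟨0, hp.M_pos⟩⟩
  simp_rw [fun i => (ha i).secRad_eq]
  have hbdd : BddBelow (Set.range fun b => ‖x b ω‖) :=
    ⟨0, by rintro _ ⟨b, rfl⟩; exact norm_nonneg _⟩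
  refine le_antisymm (le_ciInf fun i => ciInf_le hbdd (a i)) (le_ciInf fun b => ?_)
  obtain ⟨i, hi⟩ := hp.exists_mem_sector (x b ω)
  exact (ciInf_le (Set.finite_range _).bddBelow i).trans ((ha i).norm_le hi)

namespace IsPoissonProcess

variable {Ω : Type*} [MeasurableSpace Ω] {P : Measure Ω} [IsProbabilityMeasure P]
  {x : ℕ → Ω → ℂ}

/-- Points at equal distance lie in a common annulus. The disk of radius `√K` is cut into `K * (n +
1)` annuli of area `π / (n + 1)`; each contains two points with probability of order `(n + 1)⁻²`, so
a tie there has probability of order `1 / (n + 1)` for every `n`. Coincident points with different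
indices are excluded at the same time. -/
lemma ae_norm_injective {lam : ℝ} (h : IsPoissonProcess P lam x) :
    ∀ᵐ ω ∂P, ∀ b b', b ≠ b' → ‖x b ω‖ ≠ ‖x b' ω‖ := by
  -- annuli of equal area
  set C : ℕ → ℕ → Set ℂ := fun n m => {w | ‖w‖ ^ 2 * (n + 1) ∈ Set.Ico (m : ℝ) (m + 1)} with hC
  have hCm : ∀ n m, MeasurableSet (C n m) := fun n m =>
    (show Measurable fun w : ℂ => ‖w‖ ^ 2 * ((n : ℝ) + 1) by fun_prop) measurableSet_Ico
  have hCv : ∀ n m, volume (C n m) = ENNReal.ofReal (Real.pi / (n + 1)) := by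
    intro n m
    have hn : (0 : ℝ) < n + 1 := by positivity
    have key : ∀ (k : ℝ) (w : ℂ), 0 ≤ k →
        (w ∈ Metric.ball (0 : ℂ) (Real.sqrt (k / (n + 1))) ↔ ‖w‖ ^ 2 * (n + 1) < k) := by
      intro k w hk
      rw [mem_ball_zero_iff, Real.lt_sqrt (norm_nonneg _), lt_div_iff₀ hn]
    have hset : C n m = Metric.ball 0 (Real.sqrt ((m + 1) / (n + 1))) \
        Metric.ball 0 (Real.sqrt (m / (n + 1))) := by
      ext w
      rw [Set.mem_sdiff, key _ _ (by positivity), key _ _ (by positivity), not_lt, and_comm]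
      rfl
    rw [hset, measure_sdiff _ measurableSet_ball.nullMeasurableSet measure_ball_lt_top.ne,
      Complex.volume_ball, Complex.volume_ball, ← ENNReal.ofReal_pow (Real.sqrt_nonneg _),
      ← ENNReal.ofReal_pow (Real.sqrt_nonneg _), Real.sq_sqrt (by positivity),
      Real.sq_sqrt (by positivity)]
    · have e : (NNReal.pi : ℝ≥0∞) = ENNReal.ofReal Real.pi := by
        rw [← NNReal.coe_real_pi, ENNReal.ofReal_coe_nnreal]
      rw [e, ← ENNReal.ofReal_mul (by positivity), ← ENNReal.ofReal_mul (by positivity),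
        ← ENNReal.ofReal_sub _ (by positivity)]
      congr 1
      field_simp
      ring
    · exact Metric.ball_subset_ball (Real.sqrt_le_sqrt (by gcongr; linarith))
  have hle : ∀ n m, P {ω | 2 ≤ pts (fun b => x b ω) (C n m)}
      ≤ ENNReal.ofReal ((|lam| * Real.pi) ^ 2 / (n + 1) ^ 2) := by
    intro n m
    refine (h.measure_two_le_pts_apply (hCm n m) (by rw [hCv]; exact ENNReal.ofReal_ne_top)).trans
      (ENNReal.ofReal_le_ofReal ?_)
    have hm : (mean lam (C n m) : ℝ) ≤ |lam| * (Real.pi / (n + 1)) := by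
      change (ENNReal.ofReal lam * volume (C n m)).toReal ≤ _
      have hn : 0 ≤ Real.pi / ((n : ℝ) + 1) := by positivity
      have hl : max lam 0 ≤ |lam| := by
        rcases max_choice lam 0 with h | h <;> rw [h]
        exacts [le_abs_self _, abs_nonneg _]
      rw [hCv, ENNReal.toReal_mul, ENNReal.toReal_ofReal hn, ENNReal.toReal_ofReal']
      exact mul_le_mul_of_nonneg_right hl hn
    calc (mean lam (C n m) : ℝ) ^ 2 ≤ (|lam| * (Real.pi / (n + 1))) ^ 2 := by gcongr
      _ = _ := by rw [← div_pow, mul_div_assoc]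
  -- ties within distance `√K`
  have hK : ∀ K : ℕ, ∀ᵐ ω ∂P, ¬ ∃ b b', b ≠ b' ∧ ‖x b ω‖ = ‖x b' ω‖ ∧ ‖x b ω‖ ^ 2 < K := by
    intro K
    rw [ae_iff]
    simp only [not_not]
    set N := {ω | ∃ b b', b ≠ b' ∧ ‖x b ω‖ = ‖x b' ω‖ ∧ ‖x b ω‖ ^ 2 < K} with hN
    have hsub : ∀ n : ℕ, N ⊆ ⋃ m ∈ Finset.range (K * (n + 1)),
        {ω | 2 ≤ pts (fun b => x b ω) (C n m)} := by
      rintro n ω ⟨b, b', hbb, heq, hlt⟩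
      have hn : (0 : ℝ) < n + 1 := by positivity
      set y := ‖x b ω‖ ^ 2 * ((n : ℝ) + 1) with hy
      have hy0 : 0 ≤ y := by positivity
      simp only [Set.mem_iUnion, Finset.mem_range]
      refine ⟨⌊y⌋₊, (Nat.floor_lt hy0).2 ?_, ?_⟩
      · push_cast
        exact mul_lt_mul_of_pos_right hlt hn
      · have hb : x b ω ∈ C n ⌊y⌋₊ := ⟨Nat.floor_le hy0, Nat.lt_floor_add_one y⟩
        have hb' : x b' ω ∈ C n ⌊y⌋₊ := by
          change ‖x b' ω‖ ^ 2 * ((n : ℝ) + 1) ∈ Set.Ico (⌊y⌋₊ : ℝ) (⌊y⌋₊ + 1)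
          rw [← heq]
          exact hb
        rw [Set.mem_ofPred_eq, ← lintegral_indicator_one (hCm _ _),
          lintegral_pts _ (measurable_one.indicator (hCm _ _))]
        refine le_trans ?_ (ENNReal.sum_le_tsum {b, b'})
        rw [Finset.sum_pair hbb, Set.indicator_of_mem hb, Set.indicator_of_mem hb']
        simp only [Pi.one_apply]
        rw [one_add_one_eq_two]
    have hbound : ∀ n : ℕ, P N ≤ ENNReal.ofReal (K * (|lam| * Real.pi) ^ 2 / (n + 1)) := by
      intro n
      refine (measure_mono (hsub n)).trans ((measure_biUnion_finset_le _ _).trans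
        ((Finset.sum_le_sum fun m _ => hle n m).trans ?_))
      rw [Finset.sum_const, Finset.card_range, nsmul_eq_mul,
        ← ENNReal.ofReal_natCast, ← ENNReal.ofReal_mul (by positivity)]
      refine ENNReal.ofReal_le_ofReal (le_of_eq ?_)
      push_cast
      field_simp
    have hlim : Tendsto (fun n : ℕ => ENNReal.ofReal (K * (|lam| * Real.pi) ^ 2 / (n + 1))) atTop
        (𝓝 0) := by
      rw [← ENNReal.ofReal_zero]
      refine ENNReal.tendsto_ofReal ?_
      have := (tendsto_one_div_add_atTop_nhds_zero_nat (𝕜 := ℝ)).const_mul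
        (K * (|lam| * Real.pi) ^ 2)
      simpa [div_eq_mul_inv] using this
    exact le_antisymm (ge_of_tendsto' hlim hbound) bot_le
  filter_upwards [ae_all_iff.2 hK] with ω hω b b' hbb heq
  obtain ⟨K, hK⟩ := exists_nat_gt (‖x b ω‖ ^ 2)
  exact hω K ⟨b, b', hbb, heq, hK⟩

variable {p : Params}

lemma mean_sector_ball (hp : p.Valid) (i : Fin p.M) {t : ℝ} (ht : 0 ≤ t) :
    (mean p.lam (p.sector i ∩ Metric.ball 0 t) : ℝ) = p.lam * Real.pi * t ^ 2 / p.M := by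
  change (ENNReal.ofReal p.lam * volume _).toReal = _
  have := hp.lam_pos
  rw [volume_sector_inter_ball hp i ht, ← ENNReal.ofReal_mul hp.lam_pos.le,
    ENNReal.toReal_ofReal (by positivity)]
  ring

lemma measure_sector_ball_empty (h : IsPoissonProcess P p.lam x) (hp : p.Valid) (i : Fin p.M)
    {t : ℝ} (ht : 0 ≤ t) :
    P {ω | pts (fun b => x b ω) (p.sector i ∩ Metric.ball 0 t) = 0}
      = ENNReal.ofReal (Real.exp (-(p.lam * Real.pi * t ^ 2 / p.M))) := by
  rw [h.measure_pts_apply_eq_zero ((p.measurableSet_sector i).inter measurableSet_ball)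
    (measure_ne_top_of_subset Set.inter_subset_right measure_ball_lt_top.ne),
    mean_sector_ball hp i ht]

/-- Almost surely every ball contains finitely many points, the sector is not empty since void
probabilities tend to 0, no point is at the origin, and no two distances agree. A minimum over the
finite nonempty set of points of the sector in a large ball then exists, and it is strict. -/
lemma ae_uniqueBest (h : IsPoissonProcess P p.lam x) (hp : p.Valid) :
    ∀ᵐ ω ∂P, ∀ i, ∃ a, p.UniqueBest (fun b => x b ω) i a := by
  rw [ae_all_iff]
  intro i
  have hM : (0 : ℝ) < p.M := by exact_mod_cast hp.M_pos
  have hlam := hp.lam_pos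
  have h1 : ∀ᵐ ω ∂P, ∀ n : ℕ, pts (fun b => x b ω) (Metric.ball 0 n) < ∞ :=
    ae_all_iff.2 fun n => h.ae_pts_apply_lt_top measurableSet_ball measure_ball_lt_top.ne
  have h2 : ∀ᵐ ω ∂P, ∃ n : ℕ, pts (fun b => x b ω) (p.sector i ∩ Metric.ball 0 n) ≠ 0 := by
    rw [ae_iff]
    simp only [ne_eq, not_exists, not_not]
    have hlim : Tendsto (fun n : ℕ => ENNReal.ofReal
        (Real.exp (-(p.lam * Real.pi * (n : ℝ) ^ 2 / p.M)))) atTop (𝓝 0) := by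
      rw [← ENNReal.ofReal_zero]
      refine ENNReal.tendsto_ofReal (Real.tendsto_exp_neg_atTop_nhds_zero.comp ?_)
      have hc : 0 < p.lam * Real.pi / p.M := by positivity
      have := ((tendsto_pow_atTop (two_ne_zero)).comp
        (tendsto_natCast_atTop_atTop (R := ℝ))).const_mul_atTop hc
      refine this.congr fun n => ?_
      simp only [Function.comp_apply]
      ring
    refine le_antisymm (ge_of_tendsto' hlim fun n => ?_) bot_le
    rw [← h.measure_sector_ball_empty hp i (Nat.cast_nonneg n)]
    exact measure_mono fun ω hω => hω n
  have h3 : ∀ᵐ ω ∂P, pts (fun b => x b ω) {0} = 0 := by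
    rw [ae_iff]
    have e := h.measure_pts_apply_eq_zero (A := {0}) (measurableSet_singleton _) (by simp)
    simp only [mean, measure_singleton, mul_zero, ENNReal.toNNReal_zero, NNReal.coe_zero,
      neg_zero, Real.exp_zero, ENNReal.ofReal_one] at e
    exact (prob_compl_eq_zero_iff (measurable_pts_apply h.measurable (measurableSet_singleton _)
      (measurableSet_singleton 0))).2 e
  filter_upwards [h1, h2, h3, h.ae_norm_injective] with ω h1 h2 h3 h4
  obtain ⟨n, hn⟩ := h2
  set I : Set ℕ := {b | x b ω ∈ p.sector i ∩ Metric.ball 0 n} with hI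
  have hIfin : I.Finite := by
    have : pts (fun b => x b ω) (p.sector i ∩ Metric.ball 0 n) < ∞ :=
      (measure_mono Set.inter_subset_right).trans_lt (h1 n)
    rw [pts_apply x ((p.measurableSet_sector i).inter measurableSet_ball)] at this
    rw [← Set.encard_lt_top_iff]
    exact ENat.toENNReal_lt_top.1 this
  have hIne : I.Nonempty := by
    by_contra hc
    rw [Set.not_nonempty_iff_eq_empty] at hc
    refine hn ((pts_eq_zero_iff _ ((p.measurableSet_sector i).inter measurableSet_ball)).2 ?_)
    intro b hb
    exact Set.eq_empty_iff_forall_notMem.1 hc b hb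
  obtain ⟨a, haI, ha⟩ := Set.exists_min_image I (fun b => ‖x b ω‖) hIfin hIne
  refine ⟨a, haI.1, ?_, fun b hba hb => ?_⟩
  · rw [norm_pos_iff]
    exact (pts_eq_zero_iff _ (measurableSet_singleton _)).1 h3 a
  · by_cases hbI : x b ω ∈ Metric.ball (0 : ℂ) n
    · exact lt_of_le_of_ne (ha b ⟨hb, hbI⟩) (h4 a b (Ne.symm hba))
    · have h5 := haI.2
      rw [mem_ball_zero_iff] at h5 hbI
      exact h5.trans_le (not_lt.1 hbI)

end IsPoissonProcess

/-! ### The law of the distance to the nearest base station of a sector -/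

lemma Params.Valid.sectorDensity_nonneg {p : Params} (hp : p.Valid) {r : ℝ} (hr : 0 ≤ r) :
    0 ≤ p.sectorDensity r := by
  have := hp.lam_pos
  unfold Params.sectorDensity
  positivity

lemma Params.continuous_sectorDensity (p : Params) : Continuous p.sectorDensity := by
  unfold Params.sectorDensity
  fun_prop

lemma Params.hasDerivAt_exp_sq (p : Params) (r : ℝ) :
    HasDerivAt (fun r => -Real.exp (-(p.lam * Real.pi * r ^ 2 / p.M))) (p.sectorDensity r) r := by
  have h1 : HasDerivAt (fun r : ℝ => -(p.lam * Real.pi * r ^ 2 / p.M))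
      (-(p.lam * Real.pi * (2 * r) / p.M)) r := by
    have := ((((hasDerivAt_pow 2 r).const_mul (p.lam * Real.pi)).div_const (p.M : ℝ))).fun_neg
    simpa using this
  have h2 := h1.exp.neg
  convert! h2 using 1
  unfold Params.sectorDensity
  ring

lemma Params.Valid.tendsto_exp_sq {p : Params} (hp : p.Valid) :
    Tendsto (fun r : ℝ => -Real.exp (-(p.lam * Real.pi * r ^ 2 / p.M))) atTop (𝓝 0) := by
  have hM : (0 : ℝ) < p.M := by exact_mod_cast hp.M_pos
  have hlam := hp.lam_pos
  rw [← neg_zero]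
  refine (Real.tendsto_exp_neg_atTop_nhds_zero.comp ?_).neg
  have hc : 0 < p.lam * Real.pi / p.M := by positivity
  refine ((tendsto_pow_atTop (two_ne_zero)).const_mul_atTop hc).congr fun n => ?_
  ring

lemma Params.Valid.integrableOn_sectorDensity {p : Params} (hp : p.Valid) {r : ℝ} (hr : 0 ≤ r) :
    IntegrableOn p.sectorDensity (Set.Ioi r) :=
  integrableOn_Ioi_deriv_of_nonneg
    (p.hasDerivAt_exp_sq r).continuousAt.continuousWithinAt
    (fun s _ => p.hasDerivAt_exp_sq s)
    (fun _ hs => hp.sectorDensity_nonneg (hr.trans (le_of_lt hs))) hp.tendsto_exp_sq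

lemma Params.Valid.lintegral_sectorDensity {p : Params} (hp : p.Valid) {r : ℝ} (hr : 0 ≤ r) :
    ∫⁻ s in Set.Ioi r, ENNReal.ofReal (p.sectorDensity s)
      = ENNReal.ofReal (Real.exp (-(p.lam * Real.pi * r ^ 2 / p.M))) := by
  rw [← ofReal_integral_eq_lintegral_ofReal (hp.integrableOn_sectorDensity hr)
    ((ae_restrict_iff' measurableSet_Ioi).2 (ae_of_all _ fun s hs =>
      hp.sectorDensity_nonneg (hr.trans (le_of_lt hs)))),
    integral_Ioi_of_hasDerivAt_of_tendsto
      (p.hasDerivAt_exp_sq r).continuousAt.continuousWithinAt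
      (fun s _ => p.hasDerivAt_exp_sq s) (hp.integrableOn_sectorDensity hr)
      hp.tendsto_exp_sq]
  simp

/-- The law of the distance to the nearest BS of one sector. -/
noncomputable def Params.radLaw (p : Params) : Measure ℝ :=
  (volume.restrict (Set.Ioi 0)).withDensity fun r => ENNReal.ofReal (p.sectorDensity r)

lemma Params.Valid.radLaw_Ioi {p : Params} (hp : p.Valid) {r : ℝ} (hr : 0 ≤ r) :
    p.radLaw (Set.Ioi r) = ENNReal.ofReal (Real.exp (-(p.lam * Real.pi * r ^ 2 / p.M))) := by
  rw [Params.radLaw, withDensity_apply _ measurableSet_Ioi,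
    Measure.restrict_restrict measurableSet_Ioi, Set.Ioi_inter_Ioi, max_eq_left hr,
    hp.lintegral_sectorDensity hr]

/-- Up to a null set, `R_i ≥ s` says that the open sector disk of radius `s` is empty, which has the
same probability as the tail of `radLaw`. Half-lines determine the law. -/
lemma Params.Valid.map_secRad {Ω : Type*} [MeasurableSpace Ω] {P : Measure Ω}
    [IsProbabilityMeasure P] {x : ℕ → Ω → ℂ} {p : Params} (hp : p.Valid)
    (h : IsPoissonProcess P p.lam x) (i : Fin p.M) :
    P.map (fun ω => p.secRad i fun b => x b ω) = p.radLaw := by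
  have hm : Measurable fun ω => p.secRad i fun b => x b ω :=
    (p.measurable_secRad i).comp (measurable_pi_lambda _ h.measurable)
  have := Measure.isProbabilityMeasure_map (μ := P) hm.aemeasurable
  refine Measure.ext_of_Ici _ _ fun t => ?_
  rw [Measure.map_apply hm measurableSet_Ici]
  have hkey : ∀ s : ℝ, 0 ≤ s → P ((fun ω => p.secRad i fun b => x b ω) ⁻¹' Set.Ici s)
      = ENNReal.ofReal (Real.exp (-(p.lam * Real.pi * s ^ 2 / p.M))) := by
    intro s hs
    rw [← h.measure_sector_ball_empty hp i hs]
    refine measure_congr ?_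
    filter_upwards [h.ae_uniqueBest hp] with ω hω
    obtain ⟨a, ha⟩ := hω i
    exact propext (ha.pts_ball_eq_zero_iff s).symm
  have hac : p.radLaw ≪ volume.restrict (Set.Ioi 0) := withDensity_absolutelyContinuous _ _
  rcases le_or_gt 0 t with ht | ht
  · rw [hkey t ht, ← hp.radLaw_Ioi ht]
    refine measure_congr ?_
    exact (hac.trans Measure.restrict_le_self.absolutelyContinuous).ae_eq Ioi_ae_eq_Ici
  · have e1 : (fun ω => p.secRad i fun b => x b ω) ⁻¹' Set.Ici t = Set.univ := by
      ext ω
      simp only [Set.mem_preimage, Set.mem_Ici, Set.mem_univ, iff_true]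
      exact ht.le.trans ENNReal.toReal_nonneg
    have e2 : p.radLaw (Set.Ici t) = p.radLaw (Set.Ioi 0) := by
      simp only [Params.radLaw]
      rw [withDensity_apply _ measurableSet_Ici, withDensity_apply _ measurableSet_Ioi,
        Measure.restrict_restrict measurableSet_Ici, Measure.restrict_restrict measurableSet_Ioi,
        Set.inter_self, Set.inter_eq_right.2]
      exact fun s hs => ht.le.trans (le_of_lt hs)
    rw [e1, e2, measure_univ, hp.radLaw_Ioi le_rfl]
    simp


/-! ### Averaging the detection probability over the interferers -/

/-- Conditional probability that sector `i` is missed in `j` cycles given the configuration `z` of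
BSs, if the nearest BS of the sector is at distance `r`. -/
noncomputable def Params.missProb (p : Params) (j : ℕ) (i : Fin p.M) (r : ℝ) (z : ℕ → ℂ) :
    ℝ≥0∞ :=
  (1 - p.detProb i r z) ^ j

lemma Params.missProb_le_one (p : Params) (j : ℕ) (i : Fin p.M) (r : ℝ) (z : ℕ → ℂ) :
    p.missProb j i r z ≤ 1 :=
  pow_le_one₀ bot_le tsub_le_self

lemma Params.measurableSet_farSector (p : Params) (i : Fin p.M) (r : ℝ) :
    MeasurableSet (p.farSector i r) :=
  (p.measurableSet_sector i).inter (measurableSet_lt measurable_const measurable_norm)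

lemma Params.measurable_logAtten (p : Params) : Measurable fun q : ℝ × ℝ => p.logAtten q.1 q.2 := by
  have := p.measurable_pathLoss
  unfold Params.logAtten
  fun_prop

lemma Params.measurable_logAtten_norm (p : Params) (r : ℝ) :
    Measurable fun w : ℂ => p.logAtten r ‖w‖ := by
  have := p.measurable_pathLoss
  unfold Params.logAtten
  fun_prop

lemma Params.interfExp_eq (p : Params) (i : Fin p.M) (r : ℝ) (z : ℕ → ℂ) :
    p.interfExp i r z = ∫⁻ w in p.farSector i r, p.logAtten r ‖w‖ ∂(pts z) :=
  (setLIntegral_pts z (p.measurable_logAtten_norm r) (p.measurableSet_farSector i r)).symm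

/-- For a fixed radius the miss probability depends only on the points beyond it; this is what makes
it independent of the event locating the nearest station within that radius. -/
lemma Params.measurable_region_missProb (p : Params) {Ω : Type*} (x : ℕ → Ω → ℂ) (j : ℕ)
    (i : Fin p.M) (r : ℝ) :
    Measurable[IsPoissonProcess.region x (p.farSector i r)]
      fun ω => p.missProb j i r fun b => x b ω := by
  simp_rw [Params.missProb, Params.detProb, Params.interfExp_eq]
  exact (measurable_const.sub (measurable_eexpNeg.comp (measurable_const.add
    (IsPoissonProcess.measurable_region_lintegral (p.measurableSet_farSector i r)
      (p.measurable_logAtten_norm r))))).pow_const j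

lemma Params.Valid.atten_nonneg {p : Params} (hp : p.Valid) {r t : ℝ} (hr : 0 < r) (ht : 0 < t) :
    0 ≤ p.Gam * p.pathLoss r / p.pathLoss t :=
  div_nonneg (mul_nonneg hp.Gam_pos.le (hp.pathLoss_pos hr).le) (hp.pathLoss_pos ht).le

lemma Params.Valid.one_sub_eexpNeg_logAtten {p : Params} (hp : p.Valid) {r t : ℝ} (hr : 0 < r)
    (ht : 0 < t) (k : ℕ) :
    1 - eexpNeg (k * p.logAtten r t)
      = ENNReal.ofReal (1 - 1 / (1 + p.Gam * p.pathLoss r / p.pathLoss t) ^ k) := by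
  have hc := hp.atten_nonneg hr ht
  set c := p.Gam * p.pathLoss r / p.pathLoss t
  have h1 : 0 < 1 + c := by linarith
  rw [eexpNeg_nat_mul, Params.logAtten, eexpNeg_ofReal (Real.log_nonneg (by linarith)),
    Real.exp_neg, Real.exp_log h1, ← ENNReal.ofReal_pow (by positivity), ← ENNReal.ofReal_one,
    ← ENNReal.ofReal_sub _ (by positivity), inv_pow, one_div]

lemma Params.measurable_f (p : Params) (j : ℕ) : Measurable (p.f j) := by
  have hl := p.measurable_pathLoss
  unfold Params.f
  refine Finset.measurable_fun_sum _ fun k _ => Measurable.mul (by fun_prop) ?_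
  refine measurable_expNeg.comp (Measurable.const_mul ?_ _)
  have hind : ∀ r : ℝ, ∫⁻ t in Set.Ioi r, ENNReal.ofReal
        ((1 - 1 / (1 + p.Gam * p.pathLoss r / p.pathLoss t) ^ k) * t)
      = ∫⁻ t, {q : ℝ × ℝ | q.1 < q.2}.indicator (fun q => ENNReal.ofReal
        ((1 - 1 / (1 + p.Gam * p.pathLoss q.1 / p.pathLoss q.2) ^ k) * q.2)) (r, t) := by
    intro r
    rw [← lintegral_indicator measurableSet_Ioi]
    rfl
  simp_rw [hind]
  refine Measurable.lintegral_prod_right' (Measurable.indicator (by fun_prop) ?_)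
  exact measurableSet_lt measurable_fst measurable_snd

section Average

variable {Ω : Type*} [MeasurableSpace Ω] {P : Measure Ω} [IsProbabilityMeasure P]
  {x : ℕ → Ω → ℂ} {p : Params}

/-- The k-th power multiplies the exponent by `k`, so this moment is again a generating functional;
the rotational symmetry of the integrand reduces the plane integral to a radial one. -/
lemma lintegral_eexpNeg_interfExp_pow (h : IsPoissonProcess P p.lam x) (hp : p.Valid)
    (i : Fin p.M) {r : ℝ} (hr : 0 < r) (k : ℕ) :
    ∫⁻ ω, eexpNeg (p.interfExp i r fun b => x b ω) ^ k ∂P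
      = ENNReal.ofReal (expNeg (ENNReal.ofReal (2 * p.lam * Real.pi / p.M) *
        ∫⁻ t in Set.Ioi r, ENNReal.ofReal
          ((1 - 1 / (1 + p.Gam * p.pathLoss r / p.pathLoss t) ^ k) * t))) := by
  have hg : Measurable fun w : ℂ => (k : ℝ≥0∞) * p.logAtten r ‖w‖ :=
    (p.measurable_logAtten_norm r).const_mul _
  have hfar := p.measurableSet_farSector i r
  have e1 : ∀ ω, eexpNeg (p.interfExp i r fun b => x b ω) ^ k
      = eexpNeg (∫⁻ w, (p.farSector i r).indicator (fun w => (k : ℝ≥0∞) * p.logAtten r ‖w‖) w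
        ∂(pts fun b => x b ω)) := by
    intro ω
    rw [← eexpNeg_nat_mul, p.interfExp_eq, lintegral_indicator hfar,
      lintegral_const_mul _ (p.measurable_logAtten_norm r)]
  simp_rw [e1]
  rw [h.lintegral_eexpNeg (hg.indicator hfar)]
  set G : ℝ → ℝ≥0∞ := (Set.Ioi r).indicator fun t => 1 - eexpNeg (k * p.logAtten r t) with hG
  have hGm : Measurable G := by
    refine Measurable.indicator ?_ measurableSet_Ioi
    exact measurable_one_sub_eexpNeg.comp
      ((p.measurable_logAtten.comp (measurable_const.prodMk measurable_id)).const_mul _)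
  have e2 : ∀ w : ℂ, 1 - eexpNeg ((p.farSector i r).indicator
      (fun w => (k : ℝ≥0∞) * p.logAtten r ‖w‖) w) = (p.sector i).indicator (fun w => G ‖w‖) w := by
    intro w
    by_cases h1 : w ∈ p.sector i
    · rw [Set.indicator_of_mem h1, hG]
      by_cases h2 : r < ‖w‖
      · rw [Set.indicator_of_mem (s := p.farSector i r) ⟨h1, h2⟩,
          Set.indicator_of_mem (s := Set.Ioi r) h2]
      · rw [Set.indicator_of_notMem (s := p.farSector i r) (fun h => h2 h.2),
          Set.indicator_of_notMem (s := Set.Ioi r) h2]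
        simp
    · rw [Set.indicator_of_notMem h1, Set.indicator_of_notMem (fun h => h1 h.1)]
      simp
  simp_rw [e2]
  rw [lintegral_indicator (p.measurableSet_sector i), lintegral_sector hp i hGm, ← mul_assoc,
    ← ENNReal.ofReal_mul hp.lam_pos.le, eexpNeg]
  congr 3
  · congr 1; ring
  · have e3 : ∀ t : ℝ, ENNReal.ofReal t * G t
        = (Set.Ioi r).indicator (fun t => ENNReal.ofReal t * (1 - eexpNeg (k * p.logAtten r t)))
          t := by
      intro t
      simp only [hG, Set.indicator_apply]
      split_ifs <;> simp
    simp_rw [e3]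
    rw [lintegral_indicator measurableSet_Ioi, Measure.restrict_restrict measurableSet_Ioi,
      Set.Ioi_inter_Ioi, max_eq_left hr.le]
    refine setLIntegral_congr_fun measurableSet_Ioi fun t ht => ?_
    have ht0 : 0 < t := hr.trans ht
    rw [hp.one_sub_eexpNeg_logAtten hr ht0, mul_comm, ← ENNReal.ofReal_mul' ht0.le]

/-- Expand `(1 - exp (-s) * e) ^ j` by the binomial formula and integrate each power of `e`: the
result is `f_j` literally. Nonnegativity, invisible in the alternating sum, holds because `f_j` is
the mean of a nonnegative variable. -/
lemma lintegral_missProb (h : IsPoissonProcess P p.lam x) (hp : p.Valid) (j : ℕ)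
    (i : Fin p.M) {r : ℝ} (hr : 0 < r) :
    0 ≤ p.f j r ∧ ∫⁻ ω, p.missProb j i r (fun b => x b ω) ∂P = ENNReal.ofReal (p.f j r) := by
  set e : Ω → ℝ := fun ω => expNeg (p.interfExp i r fun b => x b ω) with he
  set s : ℝ := p.Gam * p.pathLoss r * (p.W / (p.Pb * p.M)) with hs
  have hs0 : 0 ≤ s :=
    mul_nonneg (mul_nonneg hp.Gam_pos.le (hp.pathLoss_pos hr).le) hp.noise_nonneg
  have hem : Measurable e := by
    have h1 := (IsPoissonProcess.measurable_region_lintegral (x := x)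
      (p.measurableSet_farSector i r) (p.measurable_logAtten_norm r)).mono (h.region_le _) le_rfl
    refine measurable_expNeg.comp ?_
    simp_rw [p.interfExp_eq]
    exact h1
  have he0 : ∀ ω, 0 ≤ e ω := fun ω => expNeg_nonneg _
  have he1 : ∀ ω, e ω ≤ 1 := fun ω => expNeg_le_one _
  have hpow : ∀ k : ℕ, Integrable (fun ω => e ω ^ k) P := fun k =>
    Integrable.of_bound (hem.pow_const k).aestronglyMeasurable 1 (ae_of_all _ fun ω => by
      rw [Real.norm_of_nonneg (pow_nonneg (he0 ω) k)]
      exact pow_le_one₀ (he0 ω) (he1 ω))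
  have hint : ∀ k : ℕ, ∫ ω, e ω ^ k ∂P = expNeg (ENNReal.ofReal (2 * p.lam * Real.pi / p.M) *
        ∫⁻ t in Set.Ioi r, ENNReal.ofReal
          ((1 - 1 / (1 + p.Gam * p.pathLoss r / p.pathLoss t) ^ k) * t)) := by
    intro k
    rw [integral_eq_lintegral_of_nonneg_ae (ae_of_all _ fun ω => pow_nonneg (he0 ω) k)
      (hpow k).aestronglyMeasurable]
    simp_rw [fun ω => ENNReal.ofReal_pow (he0 ω) k]
    have := lintegral_eexpNeg_interfExp_pow h hp i hr k
    simp only [eexpNeg] at this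
    rw [this, ENNReal.toReal_ofReal (expNeg_nonneg _)]
  have hE1 : ∀ ω, Real.exp (-s) * e ω ≤ 1 := fun ω =>
    mul_le_one₀ (by simpa using hs0) (he0 ω) (he1 ω)
  have hmiss : ∀ ω, p.missProb j i r (fun b => x b ω)
      = ENNReal.ofReal ((1 - Real.exp (-s) * e ω) ^ j) := by
    intro ω
    rw [Params.missProb, Params.detProb, eexpNeg_add, Params.noiseExp, eexpNeg_ofReal hs0, eexpNeg,
      ← ENNReal.ofReal_mul (Real.exp_pos _).le, ← ENNReal.ofReal_one,
      ← ENNReal.ofReal_sub _ (mul_nonneg (Real.exp_pos _).le (he0 ω)),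
      ENNReal.ofReal_pow (by linarith [hE1 ω])]
  have hexp : ∀ ω, (1 - Real.exp (-s) * e ω) ^ j
      = ∑ k ∈ Finset.range (j + 1), (-1 : ℝ) ^ k * (j.choose k : ℝ) *
        Real.exp (-(p.W * k * p.Gam * p.pathLoss r / (p.Pb * p.M))) * e ω ^ k := by
    intro ω
    rw [sub_eq_neg_add, add_pow]
    refine Finset.sum_congr rfl fun k _ => ?_
    have : Real.exp (-(p.W * k * p.Gam * p.pathLoss r / (p.Pb * p.M))) = Real.exp (-s) ^ k := by
      rw [← Real.exp_nat_mul]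
      congr 1
      rw [hs]; ring
    rw [this, one_pow, neg_pow, mul_pow]
    ring
  have hf : ∫ ω, (1 - Real.exp (-s) * e ω) ^ j ∂P = p.f j r := by
    simp_rw [hexp]
    rw [integral_finsetSum _ fun k _ => (hpow k).const_mul _]
    simp_rw [integral_const_mul, hint]
    rfl
  have hnn : ∀ ω, 0 ≤ (1 - Real.exp (-s) * e ω) ^ j := fun ω =>
    pow_nonneg (by linarith [hE1 ω]) j
  refine ⟨hf ▸ integral_nonneg hnn, ?_⟩
  simp_rw [hmiss]
  rw [← hf, ofReal_integral_eq_lintegral_ofReal _ (ae_of_all _ hnn)]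
  simp_rw [hexp]
  exact integrable_finsetSum _ fun k _ => (hpow k).const_mul _

end Average

/-! ### Right continuity in the distance -/

/-- Only the limit from the right is available: the loss may jump at `RC`, where its value is that
of the far branch. -/
lemma Params.tendsto_pathLoss (p : Params) {r : ℝ} (hr : 0 < r) :
    Tendsto p.pathLoss (𝓝[>] r) (𝓝 (p.pathLoss r)) := by
  have hc : ∀ α : ℝ, ∀ C : ℝ, Tendsto (fun s : ℝ => C * s ^ α) (𝓝[>] r) (𝓝 (C * r ^ α)) :=
    fun α C => ((Real.continuousAt_rpow_const r α (Or.inl hr.ne')).tendsto.mono_left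
      nhdsWithin_le_nhds).const_mul C
  rcases lt_or_ge r p.RC with h | h
  · have e : p.pathLoss r = p.CL * r ^ p.αL := if_pos h
    rw [e]
    refine (hc p.αL p.CL).congr' ?_
    filter_upwards [nhdsWithin_le_nhds (Iio_mem_nhds h)] with s hs
    exact (if_pos hs).symm
  · have e : p.pathLoss r = p.CN * r ^ p.αN := if_neg (not_lt.2 h)
    rw [e]
    refine (hc p.αN p.CN).congr' ?_
    filter_upwards [self_mem_nhdsWithin] with s hs
    exact (if_neg (not_lt.2 (h.trans (le_of_lt hs)))).symm

/-- As the radius decreases to `r`, every point beyond `r` is eventually included and no other point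
ever is, so the summands converge. The limit passes through the sum by Fatou if it diverges at `r`,
by domination otherwise. -/
lemma Params.Valid.tendsto_interfExp {p : Params} (hp : p.Valid) (i : Fin p.M) (z : ℕ → ℂ) {r : ℝ}
    (hr : 0 < r) {s : ℕ → ℝ} (hs : Tendsto s atTop (𝓝[>] r)) :
    Tendsto (fun n => p.interfExp i (s n) z) atTop (𝓝 (p.interfExp i r z)) := by
  have hl0 := hp.pathLoss_pos hr
  have hl : Tendsto (fun n => p.pathLoss (s n)) atTop (𝓝 (p.pathLoss r)) :=
    (p.tendsto_pathLoss hr).comp hs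
  have hsr : ∀ᶠ n in atTop, r < s n := hs.eventually self_mem_nhdsWithin
  have hs' : Tendsto s atTop (𝓝 r) := hs.mono_right nhdsWithin_le_nhds
  set φ : ℝ → ℂ → ℝ≥0∞ := fun t => (p.farSector i t).indicator fun w => p.logAtten t ‖w‖ with hφ
  have hφm : ∀ t, Measurable (φ t) := fun t =>
    (p.measurable_logAtten_norm t).indicator (p.measurableSet_farSector i t)
  have hφi : ∀ t, p.interfExp i t z = ∫⁻ w, φ t w ∂(pts z) := fun t =>
    (lintegral_pts z (hφm t)).symm
  have hlim : ∀ w, Tendsto (fun n => φ (s n) w) atTop (𝓝 (φ r w)) := by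
    intro w
    by_cases hw : w ∈ p.farSector i r
    · have h1 : ∀ᶠ n in atTop, p.logAtten (s n) ‖w‖ = φ (s n) w := by
        filter_upwards [hs'.eventually (Iio_mem_nhds hw.2)] with n hn
        exact (Set.indicator_of_mem (s := p.farSector i (s n)) ⟨hw.1, hn⟩
          (fun w => p.logAtten (s n) ‖w‖)).symm
      have h2 : φ r w = p.logAtten r ‖w‖ := Set.indicator_of_mem hw _
      rw [h2]
      have h3 := hp.atten_nonneg hr (hr.trans hw.2)
      exact Tendsto.congr' h1 (ENNReal.tendsto_ofReal
        ((((hl.const_mul p.Gam).div_const (p.pathLoss ‖w‖)).const_add 1).log (by linarith)))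
    · have h2 : φ r w = 0 := Set.indicator_of_notMem hw _
      rw [h2]
      refine tendsto_const_nhds.congr' ?_
      filter_upwards [hsr] with n hn
      exact (Set.indicator_of_notMem (fun h => hw ⟨h.1, hn.trans h.2⟩) _).symm
  simp_rw [hφi]
  by_cases htop : ∫⁻ w, φ r w ∂(pts z) = ∞
  · rw [htop]
    have h1 : ∫⁻ w, φ r w ∂(pts z) ≤ liminf (fun n => ∫⁻ w, φ (s n) w ∂(pts z)) atTop := by
      refine le_trans (le_of_eq ?_) (lintegral_liminf_le fun n => hφm (s n))
      exact lintegral_congr fun w => ((hlim w).liminf_eq).symm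
    rw [htop, top_le_iff] at h1
    exact tendsto_of_le_liminf_of_limsup_le h1.ge le_top
  -- The factor 2 works because eventually `l(s n) < 2 l(r)`, and `log (1 + 2 c) ≤ 2 log (1 + c)`
  -- since `1 + 2 c ≤ (1 + c) ^ 2`.
  · refine tendsto_lintegral_filter_of_dominated_convergence (fun w => 2 * φ r w)
      (Eventually.of_forall fun n => hφm _) ?_ ?_ (ae_of_all _ hlim)
    · filter_upwards [hsr, hl.eventually (Iio_mem_nhds (by linarith : p.pathLoss r <
        2 * p.pathLoss r))] with n hn hln
      refine ae_of_all _ fun w => ?_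
      by_cases hw : w ∈ p.farSector i (s n)
      · have hwr : w ∈ p.farSector i r := ⟨hw.1, hn.trans hw.2⟩
        have hw0 : 0 < ‖w‖ := hr.trans hwr.2
        simp only [hφ]
        rw [Set.indicator_of_mem hw, Set.indicator_of_mem hwr, Params.logAtten, Params.logAtten,
          ← ENNReal.ofReal_ofNat, ← ENNReal.ofReal_mul (by norm_num)]
        refine ENNReal.ofReal_le_ofReal ?_
        have hc := hp.atten_nonneg hr hw0
        have hc' := hp.atten_nonneg (hr.trans hn) hw0
        have hcc : p.Gam * p.pathLoss (s n) / p.pathLoss ‖w‖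
            ≤ 2 * (p.Gam * p.pathLoss r / p.pathLoss ‖w‖) := by
          rw [← mul_div_assoc]
          have := hp.pathLoss_pos hw0
          have h3 := mul_le_mul_of_nonneg_left (le_of_lt hln) hp.Gam_pos.le
          exact (div_le_div_iff_of_pos_right this).2 (by linarith)
        set c := p.Gam * p.pathLoss r / p.pathLoss ‖w‖
        have h4 : 2 * Real.log (1 + c) = Real.log ((1 + c) ^ 2) := by
          rw [Real.log_pow]; norm_num
        rw [h4]
        refine Real.log_le_log (by linarith) ?_
        nlinarith
      · have : φ (s n) w = 0 := Set.indicator_of_notMem hw _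
        rw [this]
        exact bot_le
    · rw [lintegral_const_mul _ (hφm r)]
      exact ENNReal.mul_ne_top (by simp) htop

lemma Params.Valid.tendsto_missProb {p : Params} (hp : p.Valid) (j : ℕ) (i : Fin p.M) (z : ℕ → ℂ)
    {r : ℝ} (hr : 0 < r) {s : ℕ → ℝ} (hs : Tendsto s atTop (𝓝[>] r)) :
    Tendsto (fun n => p.missProb j i (s n) z) atTop (𝓝 (p.missProb j i r z)) := by
  have hn : Tendsto (fun n => p.noiseExp (s n)) atTop (𝓝 (p.noiseExp r)) :=
    ENNReal.tendsto_ofReal ((((p.tendsto_pathLoss hr).comp hs).const_mul _).mul_const _)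
  exact ENNReal.Tendsto.pow (ENNReal.Tendsto.sub tendsto_const_nhds
    ((continuous_eexpNeg.tendsto _).comp (hn.add (hp.tendsto_interfExp i z hr hs)))
    (Or.inl ENNReal.one_ne_top))

/-- Read off from the expectation formula rather than from the definition, so the possibly divergent
integrals in `f_j` need not be examined. -/
lemma tendsto_f {Ω : Type*} [MeasurableSpace Ω] {P : Measure Ω} [IsProbabilityMeasure P]
    {x : ℕ → Ω → ℂ} {p : Params} (h : IsPoissonProcess P p.lam x) (hp : p.Valid) (j : ℕ)
    {r : ℝ} (hr : 0 < r) {s : ℕ → ℝ} (hs : Tendsto s atTop (𝓝[>] r)) :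
    Tendsto (fun n => ENNReal.ofReal (p.f j (s n))) atTop (𝓝 (ENNReal.ofReal (p.f j r))) := by
  set i : Fin p.M := ⟨0, hp.M_pos⟩
  have hsr : ∀ᶠ n in atTop, r < s n := hs.eventually self_mem_nhdsWithin
  rw [← (lintegral_missProb h hp j i hr).2]
  have hm : ∀ t, Measurable fun ω => p.missProb j i t fun b => x b ω := fun t =>
    (p.measurable_region_missProb x j i t).mono (h.region_le _) le_rfl
  have := tendsto_lintegral_of_dominated_convergence (μ := P)
    (F := fun n ω => p.missProb j i (s n) fun b => x b ω) (fun _ => 1) (fun n => hm _)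
    (fun n => ae_of_all _ fun ω => p.missProb_le_one j i _ _) (by simp)
    (ae_of_all _ fun ω => hp.tendsto_missProb j i (fun b => x b ω) hr hs)
  refine this.congr' ?_
  filter_upwards [hsr] with n hn
  exact (lintegral_missProb h hp j i (hr.trans hn)).2


/-! ### Discretization of the distance to the nearest base station -/

/-- The least multiple of `1 / (n + 1)` greater than `y`. -/
noncomputable def gridUp (n : ℕ) (y : ℝ) : ℝ := ((⌊y * (n + 1)⌋₊ : ℝ) + 1) / (n + 1)

lemma lt_gridUp (n : ℕ) (y : ℝ) : y < gridUp n y := by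
  rw [gridUp, lt_div_iff₀ (by positivity)]
  exact Nat.lt_floor_add_one _

lemma tendsto_gridUp {y : ℝ} (hy : 0 ≤ y) :
    Tendsto (fun n => gridUp n y) atTop (𝓝[>] y) := by
  refine tendsto_nhdsWithin_iff.2 ⟨?_, Eventually.of_forall fun n => lt_gridUp n y⟩
  have h1 : Tendsto (fun n : ℕ => y + 1 / ((n : ℝ) + 1)) atTop (𝓝 y) := by
    simpa using (tendsto_one_div_add_atTop_nhds_zero_nat (𝕜 := ℝ)).const_add y
  refine tendsto_of_tendsto_of_tendsto_of_le_of_le tendsto_const_nhds h1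
    (fun n => (lt_gridUp n y).le) fun n => ?_
  have hn : (0 : ℝ) < n + 1 := by positivity
  change gridUp n y ≤ y + 1 / ((n : ℝ) + 1)
  rw [gridUp, add_div]
  gcongr
  rw [div_le_iff₀ hn]
  exact Nat.floor_le (by positivity)

lemma measurable_gridUp (n : ℕ) : Measurable (gridUp n) := by
  unfold gridUp
  fun_prop

/-- A closed half-line on the right has an indicator that is eventually constant along sequences
decreasing strictly to `y`. This is why the boxes below are made of `Set.Ici`. -/
lemma tendsto_indicator_Ici (c : ℝ) {y : ℝ} {s : ℕ → ℝ} (hs : Tendsto s atTop (𝓝[>] y)) :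
    Tendsto (fun n => (Set.Ici c).indicator (1 : ℝ → ℝ≥0∞) (s n)) atTop
      (𝓝 ((Set.Ici c).indicator 1 y)) := by
  refine tendsto_const_nhds.congr' ?_
  rcases le_or_gt c y with h | h
  · filter_upwards [hs.eventually self_mem_nhdsWithin] with n hn
    rw [Set.indicator_of_mem (Set.mem_Ici.2 h),
      Set.indicator_of_mem (Set.mem_Ici.2 (h.trans (le_of_lt hn)))]
    rfl
  · filter_upwards [(hs.mono_right nhdsWithin_le_nhds).eventually (Iio_mem_nhds h)] with n hn
    rw [Set.indicator_of_notMem (by simpa using h), Set.indicator_of_notMem (by simpa using hn)]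

lemma measurable_indicator_one {Ω : Type*} {m : MeasurableSpace Ω} {s : Set Ω}
    (hs : MeasurableSet s) : Measurable (s.indicator (1 : Ω → ℝ≥0∞)) :=
  measurable_one.indicator hs

/-- The nearest point of sector `i` is at distance in `[m / (n + 1), (m + 1) / (n + 1))`. -/
def Params.cellEvent {Ω : Type*} (p : Params) (x : ℕ → Ω → ℂ) (i : Fin p.M) (n m : ℕ) : Set Ω :=
  {ω | pts (fun b => x b ω) (p.sector i ∩ Metric.ball 0 ((m : ℝ) / (n + 1))) = 0 ∧
    pts (fun b => x b ω) (p.sector i ∩ Metric.ball 0 (((m : ℝ) + 1) / (n + 1))) ≠ 0}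

lemma Params.UniqueBest.mem_cellEvent_iff {Ω : Type*} {p : Params} {x : ℕ → Ω → ℂ} {i : Fin p.M}
    {a : ℕ} {ω : Ω} (ha : p.UniqueBest (fun b => x b ω) i a) (n m : ℕ) :
    ω ∈ p.cellEvent x i n m ↔ m = ⌊p.secRad i (fun b => x b ω) * (n + 1)⌋₊ := by
  have hn : (0 : ℝ) < n + 1 := by positivity
  have h0 : 0 ≤ p.secRad i (fun b => x b ω) := ENNReal.toReal_nonneg
  rw [eq_comm, Nat.floor_eq_iff (by positivity), Params.cellEvent, Set.mem_ofPred_eq, ne_eq,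
    ha.pts_ball_eq_zero_iff, ha.pts_ball_eq_zero_iff, not_le, div_le_iff₀ hn, lt_div_iff₀ hn]

namespace IsPoissonProcess

lemma region_mono {Ω : Type*} (x : ℕ → Ω → ℂ) {A B : Set ℂ} (hAB : A ⊆ B) :
    region x A ≤ region x B :=
  iSup_le fun C => le_iSup (fun C : SubRegion B =>
    MeasurableSpace.comap (fun ω => pts (fun b => x b ω) C.1) inferInstance)
    ⟨C.1, C.2.1, C.2.2.1.trans hAB, C.2.2.2⟩

lemma measurableSet_region_cellEvent {Ω : Type*} (x : ℕ → Ω → ℂ) {p : Params} (i : Fin p.M)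
    (n m : ℕ) : MeasurableSet[region x (p.sector i ∩ Metric.ball 0 (((m : ℝ) + 1) / (n + 1)))]
      (p.cellEvent x i n m) := by
  have hm : ∀ t : ℝ, t ≤ ((m : ℝ) + 1) / (n + 1) →
      Measurable[region x (p.sector i ∩ Metric.ball 0 (((m : ℝ) + 1) / (n + 1)))]
        fun ω => pts (fun b => x b ω) (p.sector i ∩ Metric.ball 0 t) := fun t ht =>
    measurable_region_pts ((p.measurableSet_sector i).inter measurableSet_ball)
      (Set.inter_subset_inter_right _ (Metric.ball_subset_ball ht))
      (measure_ne_top_of_subset Set.inter_subset_right measure_ball_lt_top.ne)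
  refine MeasurableSet.inter (hm _ (by gcongr; linarith) (measurableSet_singleton 0)) ?_
  exact (hm _ le_rfl (measurableSet_singleton 0)).compl

/-- Discretization of `1_{r ≥ c} * missProb r` at the distance `r` of the nearest BS. -/
noncomputable def gridMiss {Ω : Type*} (x : ℕ → Ω → ℂ) (p : Params) (j : ℕ) (i : Fin p.M) (c : ℝ) (n : ℕ)
    (ω : Ω) : ℝ≥0∞ :=
  ∑' m : ℕ, (p.cellEvent x i n m).indicator 1 ω *
    ((Set.Ici c).indicator 1 (((m : ℝ) + 1) / (n + 1)) *
      p.missProb j i (((m : ℝ) + 1) / (n + 1)) fun b => x b ω)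

lemma measurable_region_gridMiss {Ω : Type*} {x : ℕ → Ω → ℂ} {p : Params} (j : ℕ) (i : Fin p.M) (c : ℝ)
    (n : ℕ) : Measurable[region x (p.sector i)] (gridMiss x p j i c n) := by
  let _ : MeasurableSpace Ω := region x (p.sector i)
  refine Measurable.tsum fun m => Measurable.mul ?_ (Measurable.const_mul ?_ _)
  · exact measurable_indicator_one
      (region_mono x Set.inter_subset_left _ (measurableSet_region_cellEvent x i n m))
  · exact (p.measurable_region_missProb x j i _).mono (region_mono x Set.inter_subset_left) le_rfl

/-- Exactly one cell contains the nearest distance, and its right endpoint is `gridUp` of that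
distance. -/
lemma tsum_cellEvent_eq {Ω : Type*} {x : ℕ → Ω → ℂ} {p : Params} {i : Fin p.M} {a : ℕ} {ω : Ω}
    (ha : p.UniqueBest (fun b => x b ω) i a) (n : ℕ) (φ : ℝ → ℝ≥0∞) :
    ∑' m : ℕ, (p.cellEvent x i n m).indicator 1 ω * φ (((m : ℝ) + 1) / (n + 1))
      = φ (gridUp n (p.secRad i fun b => x b ω)) := by
  rw [tsum_eq_single ⌊p.secRad i (fun b => x b ω) * (n + 1)⌋₊]
  · rw [Set.indicator_of_mem ((ha.mem_cellEvent_iff n _).2 rfl)]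
    simp [gridUp]
  · intro m hm
    rw [Set.indicator_of_notMem fun h => hm ((ha.mem_cellEvent_iff n m).1 h), zero_mul]

variable {Ω : Type*} [MeasurableSpace Ω] {P : Measure Ω} [IsProbabilityMeasure P]
  {x : ℕ → Ω → ℂ} {p : Params}

lemma measurable_secRad {P : Measure Ω} (h : IsPoissonProcess P p.lam x) (i : Fin p.M) :
    Measurable fun ω => p.secRad i fun b => x b ω :=
  (p.measurable_secRad i).comp (measurable_pi_lambda _ h.measurable)

/-- The conditioning on the nearest distance, in discrete form. With `t` the right endpoint of the
cell, the cell event involves points within `t` and the miss probability points beyond `t`; these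
are independent, so the latter may be replaced by its mean `f_j(t)`. Rounding up rather than down is
essential here. -/
lemma lintegral_gridMiss (h : IsPoissonProcess P p.lam x) (hp : p.Valid) (j : ℕ) (i : Fin p.M)
    (c : ℝ) (n : ℕ) :
    ∫⁻ ω, gridMiss x p j i c n ω ∂P
      = ∫⁻ ω, (Set.Ici c).indicator 1 (gridUp n (p.secRad i fun b => x b ω)) *
          ENNReal.ofReal (p.f j (gridUp n (p.secRad i fun b => x b ω))) ∂P := by
  have hcell : ∀ m, MeasurableSet (p.cellEvent x i n m) := fun m =>
    h.region_le _ _ (measurableSet_region_cellEvent x i n m)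
  have hmiss : ∀ t, Measurable fun ω => p.missProb j i t fun b => x b ω := fun t =>
    (p.measurable_region_missProb x j i t).mono (h.region_le _) le_rfl
  have e1 : ∫⁻ ω, gridMiss x p j i c n ω ∂P
      = ∑' m : ℕ, ∫⁻ ω, (p.cellEvent x i n m).indicator 1 ω *
        ((Set.Ici c).indicator 1 (((m : ℝ) + 1) / (n + 1)) *
          ENNReal.ofReal (p.f j (((m : ℝ) + 1) / (n + 1)))) ∂P := by
    unfold gridMiss
    have hmeas : ∀ m : ℕ, Measurable fun ω => (p.cellEvent x i n m).indicator 1 ω *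
        ((Set.Ici c).indicator 1 (((m : ℝ) + 1) / (n + 1)) *
          p.missProb j i (((m : ℝ) + 1) / (n + 1)) fun b => x b ω) := fun m =>
      (measurable_one.indicator (hcell m)).mul ((hmiss _).const_mul _)
    rw [lintegral_tsum fun m => (hmeas m).aemeasurable]
    congr 1
    ext m
    set t : ℝ := ((m : ℝ) + 1) / (n + 1) with ht
    have ht0 : 0 < t := by positivity
    have hd : Disjoint (p.sector i ∩ Metric.ball 0 t) (p.farSector i t) := by
      rw [Set.disjoint_left]
      rintro w ⟨_, h1⟩ ⟨_, h2⟩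
      rw [mem_ball_zero_iff] at h1
      exact lt_asymm h1 h2
    have hind : Indep (region x (p.sector i ∩ Metric.ball 0 t)) (region x (p.farSector i t)) P := by
      have := (h.iIndep_region (fun b : Bool => cond b (p.sector i ∩ Metric.ball 0 t)
        (p.farSector i t)) ?_).indep (i := true) (j := false) (by simp)
      · exact this
      · rintro (_ | _) (_ | _) hne
        exacts [absurd rfl hne, hd.symm, hd, absurd rfl hne]
    rw [lintegral_mul_eq_lintegral_mul_lintegral_of_independent_measurableSpace
      (h.region_le _) (h.region_le _) hind
      (measurable_indicator_one (measurableSet_region_cellEvent x i n m))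
      ((p.measurable_region_missProb x j i t).const_mul _),
      lintegral_const_mul _ (hmiss t), (lintegral_missProb h hp j i ht0).2,
      lintegral_mul_const _ (measurable_one.indicator (hcell m))]
  rw [e1, ← lintegral_tsum fun m => ((measurable_one.indicator (hcell m)).mul_const _).aemeasurable]
  refine lintegral_congr_ae ?_
  filter_upwards [h.ae_uniqueBest hp] with ω hω
  obtain ⟨a, ha⟩ := hω i
  exact tsum_cellEvent_eq ha n fun t => (Set.Ici c).indicator 1 t * ENNReal.ofReal (p.f j t)

lemma lintegral_prod_gridMiss (h : IsPoissonProcess P p.lam x) (hp : p.Valid) (j : ℕ)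
    (c : Fin p.M → ℝ) (n : ℕ) :
    ∫⁻ ω, ∏ i, gridMiss x p j i (c i) n ω ∂P = ∏ i, ∫⁻ ω, gridMiss x p j i (c i) n ω ∂P := by
  have hm : ∀ i, Measurable (gridMiss x p j i (c i) n) := fun i =>
    (measurable_region_gridMiss j i (c i) n).mono (h.region_le _) le_rfl
  refine lintegral_prod_eq_prod_lintegral_of_indepFun _ (fun i => gridMiss x p j i (c i) n) ?_ hm
  rw [iIndepFun_iff_iIndep, iIndep_iff]
  intro s E hE
  refine (h.iIndep_region p.sector hp.disjoint_sector).meas_biInter fun i hi => ?_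
  exact (measurable_region_gridMiss j i (c i) n).comap_le _ (hE i hi)

/-- Factorization over the sectors of the probability that all sectors are missed. -/
lemma lintegral_prod_missProb (h : IsPoissonProcess P p.lam x) (hp : p.Valid) (j : ℕ)
    (c : Fin p.M → ℝ) :
    ∫⁻ ω, ∏ i, ((Set.Ici (c i)).indicator 1 (p.secRad i fun b => x b ω) *
        p.missProb j i (p.secRad i fun b => x b ω) fun b => x b ω) ∂P
      = ∏ i, ∫⁻ ω, (Set.Ici (c i)).indicator 1 (p.secRad i fun b => x b ω) *
          ENNReal.ofReal (p.f j (p.secRad i fun b => x b ω)) ∂P := by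
  have hgood := h.ae_uniqueBest hp
  have hind : ∀ c y : ℝ, (Set.Ici c).indicator (1 : ℝ → ℝ≥0∞) y ≤ 1 := fun c y =>
    Set.indicator_le_self' (fun _ _ => bot_le) y
  have hm : ∀ i n, Measurable (gridMiss x p j i (c i) n) := fun i n =>
    (measurable_region_gridMiss j i (c i) n).mono (h.region_le _) le_rfl
  have hgrid : ∀ᵐ ω ∂P, ∀ i n, gridMiss x p j i (c i) n ω
      = (Set.Ici (c i)).indicator 1 (gridUp n (p.secRad i fun b => x b ω)) *
        p.missProb j i (gridUp n (p.secRad i fun b => x b ω)) fun b => x b ω := by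
    filter_upwards [hgood] with ω hω i n
    obtain ⟨a, ha⟩ := hω i
    exact tsum_cellEvent_eq ha n fun t => (Set.Ici (c i)).indicator 1 t *
      p.missProb j i t fun b => x b ω
  have hL : Tendsto (fun n => ∫⁻ ω, ∏ i, gridMiss x p j i (c i) n ω ∂P) atTop
      (𝓝 (∫⁻ ω, ∏ i, ((Set.Ici (c i)).indicator 1 (p.secRad i fun b => x b ω) *
        p.missProb j i (p.secRad i fun b => x b ω) fun b => x b ω) ∂P)) := by
    refine tendsto_lintegral_of_dominated_convergence (fun _ => 1)
      (fun n => Finset.measurable_fun_prod _ fun i _ => hm i n) (fun n => ?_) (by simp) ?_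
    · filter_upwards [hgrid] with ω hω
      refine Finset.prod_le_one (fun _ _ => bot_le) fun i _ => ?_
      rw [hω]
      exact mul_le_one' (hind _ _) (p.missProb_le_one _ _ _ _)
    · filter_upwards [hgrid, hgood] with ω hω hg
      simp_rw [hω]
      refine ENNReal.tendsto_finsetProd_of_ne_top _ (fun i _ => ?_) fun i _ => ?_
      · obtain ⟨a, ha⟩ := hg i
        have hr : 0 < p.secRad i fun b => x b ω := ha.secRad_eq ▸ ha.2.1
        have hs := tendsto_gridUp hr.le
        exact ENNReal.Tendsto.mul (tendsto_indicator_Ici _ hs)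
          (Or.inr ((p.missProb_le_one _ _ _ _).trans_lt ENNReal.one_lt_top).ne)
          (hp.tendsto_missProb j i _ hr hs) (Or.inr ((hind _ _).trans_lt ENNReal.one_lt_top).ne)
      · exact ((mul_le_one' (hind _ _) (p.missProb_le_one _ _ _ _)).trans_lt
          ENNReal.one_lt_top).ne
  have hf1 : ∀ r, 0 < r → ENNReal.ofReal (p.f j r) ≤ 1 := by
    intro r hr
    rw [← (lintegral_missProb h hp j ⟨0, hp.M_pos⟩ hr).2]
    refine (lintegral_mono fun ω => p.missProb_le_one j _ r _).trans ?_
    simp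
  have hsr : ∀ i, Measurable fun ω => p.secRad i fun b => x b ω := h.measurable_secRad
  have hR : Tendsto (fun n => ∏ i, ∫⁻ ω, gridMiss x p j i (c i) n ω ∂P) atTop
      (𝓝 (∏ i, ∫⁻ ω, (Set.Ici (c i)).indicator 1 (p.secRad i fun b => x b ω) *
          ENNReal.ofReal (p.f j (p.secRad i fun b => x b ω)) ∂P)) := by
    simp_rw [fun i n => h.lintegral_gridMiss hp j i (c i) n]
    refine ENNReal.tendsto_finsetProd_of_ne_top _ (fun i _ => ?_) fun i _ => ?_
    · refine tendsto_lintegral_of_dominated_convergence (fun _ => 1)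
        (fun n => ?_) (fun n => ?_) (by simp) ?_
      · have hg := (measurable_gridUp n).comp (hsr i)
        exact ((measurable_one.indicator measurableSet_Ici).comp hg).mul
          (p.measurable_f j |>.comp hg).ennreal_ofReal
      · filter_upwards [hgood] with ω hω
        obtain ⟨a, ha⟩ := hω i
        have hr : 0 < p.secRad i fun b => x b ω := ha.secRad_eq ▸ ha.2.1
        exact mul_le_one' (hind _ _) (hf1 _ (hr.trans (lt_gridUp n _)))
      · filter_upwards [hgood] with ω hω
        obtain ⟨a, ha⟩ := hω i
        have hr : 0 < p.secRad i fun b => x b ω := ha.secRad_eq ▸ ha.2.1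
        have hs := tendsto_gridUp hr.le
        exact ENNReal.Tendsto.mul (tendsto_indicator_Ici _ hs) (Or.inr ENNReal.ofReal_ne_top)
          (tendsto_f h hp j hr hs) (Or.inr ((hind _ _).trans_lt ENNReal.one_lt_top).ne)
    · refine ne_top_of_le_ne_top ENNReal.one_ne_top ?_
      calc _ ≤ ∫⁻ ω, 1 ∂P := lintegral_mono_ae ?_
        _ = 1 := by simp
      filter_upwards [hgood] with ω hω
      obtain ⟨a, ha⟩ := hω i
      exact mul_le_one' (hind _ _) (hf1 _ (ha.secRad_eq ▸ ha.2.1))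
  -- For each grid the integral of the product is the product of the integrals, so both limits are
  -- limits of the same sequence.
  simp_rw [h.lintegral_prod_gridMiss hp j c] at hL
  exact tendsto_nhds_unique hL hR

end IsPoissonProcess


/-! ### The minimum of independent random variables -/

section Minimum

variable {n : ℕ} (η : Measure ℝ) [IsFiniteMeasure η]

/-- Fubini with coordinate `i` singled out: given its value `r`, each of the other `n` coordinates
must exceed `r`. -/
lemma measure_pi_strict_min (i : Fin (n + 1)) {B : Set ℝ} (hB : MeasurableSet B) :
    Measure.pi (fun _ : Fin (n + 1) => η) {y | y i ∈ B ∧ ∀ m, m ≠ i → y i < y m}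
      = ∫⁻ r in B, η (Set.Ioi r) ^ n ∂η := by
  set T : Set (ℝ × (Fin n → ℝ)) := {q | q.1 ∈ B ∧ ∀ k, q.1 < q.2 k} with hT
  have hTm : MeasurableSet T := by
    refine (measurable_fst hB).inter ?_
    have : {q : ℝ × (Fin n → ℝ) | ∀ k, q.1 < q.2 k} = ⋂ k, {q | q.1 < q.2 k} := by ext; simp
    change MeasurableSet {q : ℝ × (Fin n → ℝ) | ∀ k, q.1 < q.2 k}
    rw [this]
    exact MeasurableSet.iInter fun k =>
      measurableSet_lt measurable_fst ((measurable_pi_apply k).comp measurable_snd)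
  have hset : {y : Fin (n + 1) → ℝ | y i ∈ B ∧ ∀ m, m ≠ i → y i < y m}
      = MeasurableEquiv.piFinSuccAbove (fun _ => ℝ) i ⁻¹' T := by
    ext y
    simp only [hT, Set.mem_ofPred_eq, Set.mem_preimage, MeasurableEquiv.piFinSuccAbove_apply]
    refine and_congr Iff.rfl ⟨fun h k => h _ (Fin.succAbove_ne i k), fun h m hm => ?_⟩
    obtain ⟨k, rfl⟩ := Fin.exists_succAbove_eq hm
    exact h k
  rw [hset, (measurePreserving_piFinSuccAbove (fun _ => η) i).measure_preimage
    hTm.nullMeasurableSet, Measure.prod_apply hTm, ← lintegral_indicator hB]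
  refine lintegral_congr fun r => ?_
  by_cases hr : r ∈ B
  · have : Prod.mk r ⁻¹' T = Set.univ.pi fun _ => Set.Ioi r := by
      ext v
      simp [hT, hr]
    rw [this, Measure.pi_pi, Set.indicator_of_mem hr]
    simp
  · have : Prod.mk r ⁻¹' T = ∅ := by
      ext v
      simp [hT, hr]
    rw [this, Set.indicator_of_notMem hr, measure_empty]

lemma measure_pi_tie [NullSingletonClass η] {i m : Fin (n + 1)} (h : m ≠ i) :
    Measure.pi (fun _ : Fin (n + 1) => η) {y | y i = y m} = 0 := by
  obtain ⟨k, rfl⟩ := Fin.exists_succAbove_eq h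
  set T : Set (ℝ × (Fin n → ℝ)) := {q | q.1 = q.2 k} with hT
  have hTm : MeasurableSet T :=
    measurableSet_eq_fun measurable_fst ((measurable_pi_apply k).comp measurable_snd)
  have hset : {y : Fin (n + 1) → ℝ | y i = y (i.succAbove k)}
      = MeasurableEquiv.piFinSuccAbove (fun _ => ℝ) i ⁻¹' T := rfl
  rw [hset, (measurePreserving_piFinSuccAbove (fun _ => η) i).measure_preimage
    hTm.nullMeasurableSet, Measure.prod_apply hTm]
  refine lintegral_eq_zero_of_ae_eq_zero (ae_of_all _ fun r => ?_)
  have : Prod.mk r ⁻¹' T = (Function.eval k : (Fin n → ℝ) → ℝ) ⁻¹' ({r} : Set ℝ) := by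
    ext v
    exact eq_comm
  change Measure.pi (fun _ : Fin n => η) (Prod.mk r ⁻¹' T) = 0
  rw [this]
  exact Measure.pi_eval_preimage_null _ (measure_singleton r)

/-- The law of the minimum of independent variables with a common diffuse law. -/
lemma measure_pi_iInf_mem [NullSingletonClass η] {B : Set ℝ} (hB : MeasurableSet B) :
    Measure.pi (fun _ : Fin (n + 1) => η) {y | (⨅ i, y i) ∈ B}
      = (n + 1 : ℕ) * ∫⁻ r in B, η (Set.Ioi r) ^ n ∂η := by
  set A : Fin (n + 1) → Set (Fin (n + 1) → ℝ) := fun i =>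
    {y | y i ∈ B ∧ ∀ m, m ≠ i → y i < y m} with hA
  have hAm : ∀ i, MeasurableSet (A i) := by
    intro i
    refine (measurable_pi_apply i hB).inter ?_
    have : {y : Fin (n + 1) → ℝ | ∀ m, m ≠ i → y i < y m}
        = ⋂ (m) (_ : m ≠ i), {y | y i < y m} := by ext; simp
    change MeasurableSet {y : Fin (n + 1) → ℝ | ∀ m, m ≠ i → y i < y m}
    rw [this]
    exact MeasurableSet.iInter fun m => MeasurableSet.iInter fun _ =>
      measurableSet_lt (measurable_pi_apply i) (measurable_pi_apply m)
  have hd : Pairwise fun i m => Disjoint (A i) (A m) := by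
    intro i m him
    rw [Set.disjoint_left]
    rintro y ⟨_, h1⟩ ⟨_, h2⟩
    exact lt_asymm (h1 m him.symm) (h2 i him)
  have hae : {y : Fin (n + 1) → ℝ | (⨅ i, y i) ∈ B}
      =ᵐ[Measure.pi fun _ : Fin (n + 1) => η] ⋃ i, A i := by
    have htie : ∀ᵐ y ∂(Measure.pi fun _ : Fin (n + 1) => η), ∀ i m, m ≠ i → y i ≠ y m := by
      simp only [ae_all_iff]
      intro i m him
      rw [ae_iff]
      simpa using measure_pi_tie η him
    filter_upwards [htie] with y hy
    obtain ⟨i, hi⟩ := exists_eq_ciInf_of_finite (f := y)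
    have hmin : ∀ m, y i ≤ y m := fun m => hi ▸ ciInf_le (Set.finite_range y).bddBelow m
    refine propext ⟨fun h => ?_, fun h => ?_⟩
    · exact Set.mem_iUnion.2 ⟨i, by rw [hi]; exact h, fun m hm => lt_of_le_of_ne (hmin m)
        (hy i m hm)⟩
    · obtain ⟨k, hk, hk'⟩ := Set.mem_iUnion.1 h
      have : k = i := by
        by_contra hne
        exact absurd (hk' i (Ne.symm hne)) (not_lt.2 (hmin k))
      change (⨅ i, y i) ∈ B
      rw [← hi, ← this]
      exact hk
  rw [measure_congr hae, measure_iUnion hd hAm, tsum_fintype]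
  simp_rw [hA, fun i => measure_pi_strict_min η i hB]
  simp

lemma measure_pi_iInf_mem_of_pos [NullSingletonClass η] {M : ℕ} (hM : 1 ≤ M) {B : Set ℝ}
    (hB : MeasurableSet B) :
    Measure.pi (fun _ : Fin M => η) {y | (⨅ i, y i) ∈ B}
      = M * ∫⁻ r in B, η (Set.Ioi r) ^ (M - 1) ∂η := by
  obtain ⟨n, rfl⟩ : ∃ n, M = n + 1 := ⟨M - 1, by omega⟩
  exact measure_pi_iInf_mem η hB

end Minimum

/-! ### The joint law of the distances on the event that all sectors are missed -/

/-- The law of the distance to the nearest BS of a sector on the event that the sector is missed in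
`j` cycles. -/
noncomputable def Params.missLaw (p : Params) (j : ℕ) : Measure ℝ :=
  p.radLaw.withDensity fun y => ENNReal.ofReal (p.f j y)

section Joint

variable {Ω : Type*} [MeasurableSpace Ω] {P : Measure Ω} [IsProbabilityMeasure P]
  {x : ℕ → Ω → ℂ} {p : Params}

lemma f_nonneg (h : IsPoissonProcess P p.lam x) (hp : p.Valid) (j : ℕ) {r : ℝ} (hr : 0 < r) :
    0 ≤ p.f j r :=
  (lintegral_missProb h hp j ⟨0, hp.M_pos⟩ hr).1

lemma f_le_one (h : IsPoissonProcess P p.lam x) (hp : p.Valid) (j : ℕ) {r : ℝ} (hr : 0 < r) :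
    p.f j r ≤ 1 := by
  rw [← ENNReal.ofReal_le_one, ← (lintegral_missProb h hp j ⟨0, hp.M_pos⟩ hr).2]
  refine (lintegral_mono fun ω => p.missProb_le_one j _ r _).trans ?_
  simp

lemma Params.ae_radLaw_pos (p : Params) : ∀ᵐ r ∂p.radLaw, 0 < r :=
  (withDensity_absolutelyContinuous _ _).ae_le (ae_restrict_mem measurableSet_Ioi)

lemma Params.Valid.isProbabilityMeasure_radLaw (hp : p.Valid) : IsProbabilityMeasure p.radLaw := by
  constructor
  have h1 := hp.radLaw_Ioi le_rfl
  have h2 : p.radLaw (Set.Ioi 0) = p.radLaw Set.univ := by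
    refine measure_congr ?_
    filter_upwards [p.ae_radLaw_pos] with r hr
    exact propext ⟨fun _ => trivial, fun _ => hr⟩
  rw [← h2, h1]
  simp

lemma isFiniteMeasure_missLaw (h : IsPoissonProcess P p.lam x) (hp : p.Valid) (j : ℕ) :
    IsFiniteMeasure (p.missLaw j) := by
  have := hp.isProbabilityMeasure_radLaw
  refine isFiniteMeasure_withDensity (ne_top_of_le_ne_top ENNReal.one_ne_top ?_)
  calc ∫⁻ y, ENNReal.ofReal (p.f j y) ∂p.radLaw ≤ ∫⁻ y, 1 ∂p.radLaw := by
        refine lintegral_mono_ae ?_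
        filter_upwards [p.ae_radLaw_pos] with y hy
        exact ENNReal.ofReal_le_one.2 (f_le_one h hp j hy)
    _ = 1 := by simp

lemma Params.noAtoms_missLaw (p : Params) (j : ℕ) : NullSingletonClass (p.missLaw j) := by
  have h1 : p.missLaw j ≪ volume :=
    (withDensity_absolutelyContinuous _ _).trans ((withDensity_absolutelyContinuous _ _).trans
      Measure.restrict_le_self.absolutelyContinuous)
  exact ⟨fun y => h1 (measure_singleton y)⟩

/-- Products of half-lines `Set.Ici` form a generating π-system, and on them the claim is the
factorization `lintegral_prod_missProb` together with the law of one distance. -/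
lemma map_secRad_withDensity (h : IsPoissonProcess P p.lam x) (hp : p.Valid) (j : ℕ) :
    (P.withDensity fun ω => ∏ i, p.missProb j i (p.secRad i fun b => x b ω) fun b => x b ω).map
      (fun ω i => p.secRad i fun b => x b ω) = Measure.pi fun _ => p.missLaw j := by
  have hsr : ∀ i, Measurable fun ω => p.secRad i fun b => x b ω := h.measurable_secRad
  have hfin := isFiniteMeasure_missLaw h hp j
  symm
  refine Measure.pi_eq_generateFrom (C := fun _ => Set.range Set.Ici)
    (fun _ => ?_) (fun _ => isPiSystem_Ici) (fun _ => ?_) ?_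
  · rw [← borel_eq_generateFrom_Ici]
    exact (BorelSpace.measurable_eq).symm
  · exact { set := fun n => Set.Ici (-(n : ℝ))
            set_mem := fun n => ⟨_, rfl⟩
            finite := fun n => measure_lt_top _ _
            spanning := by
              refine Set.eq_univ_of_forall fun y => Set.mem_iUnion.2 ?_
              obtain ⟨n, hn⟩ := exists_nat_gt (-y)
              exact ⟨n, by simp only [Set.mem_Ici]; linarith⟩ }
  · intro s hs
    choose c hc using hs
    obtain rfl : (fun i => Set.Ici (c i)) = s := funext hc
    have hbox : MeasurableSet (Set.univ.pi fun i => Set.Ici (c i)) :=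
      MeasurableSet.univ_pi fun _ => measurableSet_Ici
    have hv : Measurable fun ω i => p.secRad i fun b => x b ω := measurable_pi_lambda _ hsr
    rw [Measure.map_apply hv hbox, withDensity_apply _ (hv hbox),
      ← lintegral_indicator (hv hbox)]
    have hmem : ∀ ω, ω ∈ (fun ω i => p.secRad i fun b => x b ω) ⁻¹'
        (Set.univ.pi fun i => Set.Ici (c i)) ↔ ∀ i, p.secRad i (fun b => x b ω) ∈ Set.Ici (c i) :=
      fun ω => ⟨fun h i => h i trivial, fun h i _ => h i⟩
    have e1 : ∀ ω, ((fun ω i => p.secRad i fun b => x b ω) ⁻¹'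
          (Set.univ.pi fun i => Set.Ici (c i))).indicator
          (fun ω => ∏ i, p.missProb j i (p.secRad i fun b => x b ω) fun b => x b ω) ω
        = ∏ i, ((Set.Ici (c i)).indicator 1 (p.secRad i fun b => x b ω) *
          p.missProb j i (p.secRad i fun b => x b ω) fun b => x b ω) := by
      intro ω
      by_cases hω : ∀ i, p.secRad i (fun b => x b ω) ∈ Set.Ici (c i)
      · rw [Set.indicator_of_mem ((hmem ω).2 hω)]
        refine Finset.prod_congr rfl fun i _ => ?_
        rw [Set.indicator_of_mem (hω i), Pi.one_apply, one_mul]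
      · rw [Set.indicator_of_notMem fun h => hω ((hmem ω).1 h)]
        push Not at hω
        obtain ⟨i, hi⟩ := hω
        refine (Finset.prod_eq_zero (Finset.mem_univ i) ?_).symm
        rw [Set.indicator_of_notMem hi, zero_mul]
    simp_rw [e1]
    rw [h.lintegral_prod_missProb hp j c]
    refine Finset.prod_congr rfl fun i _ => ?_
    have hfm := (p.measurable_f j).ennreal_ofReal
    rw [Params.missLaw, withDensity_apply _ measurableSet_Ici, ← lintegral_indicator
      measurableSet_Ici, ← hp.map_secRad h i, lintegral_map (hfm.indicator measurableSet_Ici)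
      (hsr i)]
    refine lintegral_congr fun ω => ?_
    simp only [Set.indicator_apply]
    split_ifs <;> simp

/-- The probability that all sectors are missed in `j` cycles, given the configuration, averaged
over the event that the nearest BS is at a distance in `B`. -/
lemma lintegral_nearestDist_miss (h : IsPoissonProcess P p.lam x) (hp : p.Valid) (j : ℕ)
    {B : Set ℝ} (hB : MeasurableSet B) :
    ∫⁻ ω in {ω | nearestDist x ω ∈ B},
        ∏ i, p.missProb j i (p.secRad i fun b => x b ω) (fun b => x b ω) ∂P
      = p.M * ∫⁻ r in B, p.missLaw j (Set.Ioi r) ^ (p.M - 1) ∂(p.missLaw j) := by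
  have hv : Measurable fun ω i => p.secRad i fun b => x b ω :=
    measurable_pi_lambda _ h.measurable_secRad
  have hB' : MeasurableSet {y : Fin p.M → ℝ | (⨅ i, y i) ∈ B} :=
    (Measurable.iInf fun i => measurable_pi_apply i) hB
  have e1 : {ω | nearestDist x ω ∈ B} =ᵐ[P]
      (fun ω i => p.secRad i fun b => x b ω) ⁻¹' {y | (⨅ i, y i) ∈ B} := by
    filter_upwards [h.ae_uniqueBest hp] with ω hω
    choose a ha using hω
    change (nearestDist x ω ∈ B) = ((⨅ i, p.secRad i fun b => x b ω) ∈ B)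
    rw [nearestDist_eq hp ha]
  rw [setLIntegral_congr e1, ← withDensity_apply _ (hv hB'), ← Measure.map_apply hv hB',
    map_secRad_withDensity h hp j]
  have hfin := isFiniteMeasure_missLaw h hp j
  have hna := p.noAtoms_missLaw j
  exact measure_pi_iInf_mem_of_pos _ hp.M_pos hB

end Joint


/-! ### Measurability of the number of cycles -/

/-- No success in cycles `1, …, j`. -/
def Params.NoSuccess {Ω : Type*} (p : Params) (x : ℕ → Ω → ℂ) (F : ℕ → ℕ → Ω → ℝ) (j : ℕ) : Set Ω :=
  {ω | ∀ n ∈ Finset.Icc 1 j, ¬ p.Success x F n ω}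

/-- The tail-sum formula: `NoSuccess j` says that the number of cycles exceeds `j`. The term `j = 0`
is always 1, and all terms are 1 if cell search never succeeds. -/
lemma numCycles_eq_tsum {Ω : Type*} (p : Params) (x : ℕ → Ω → ℂ) (F : ℕ → ℕ → Ω → ℝ) (ω : Ω) :
    p.numCycles x F ω = ∑' j : ℕ, (p.NoSuccess x F j).indicator 1 ω := by
  classical
  by_cases h : ∃ n, 1 ≤ n ∧ p.Success x F n ω
  · have hN := Nat.find_spec h
    have hmin := fun m => Nat.find_min h (m := m)
    set N := Nat.find h
    have e1 : p.numCycles x F ω = N := by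
      refine le_antisymm (iInf₂_le_of_le N hN.1 (iInf_le _ hN.2)) ?_
      refine le_iInf₂ fun n hn => le_iInf fun hs => ?_
      exact_mod_cast not_lt.1 fun hlt => hmin n hlt ⟨hn, hs⟩
    have e2 : ∀ j, ω ∈ p.NoSuccess x F j ↔ j ∈ Finset.range N := by
      intro j
      rw [Finset.mem_range]
      constructor
      · intro hj
        by_contra hc
        exact hj N (Finset.mem_Icc.2 ⟨hN.1, not_lt.1 hc⟩) hN.2
      · intro hj n hn hs
        rw [Finset.mem_Icc] at hn
        exact hmin n (hn.2.trans_lt hj) ⟨hn.1, hs⟩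
    rw [e1, tsum_eq_sum (s := Finset.range N) fun j hj =>
      Set.indicator_of_notMem (fun h => hj ((e2 j).1 h)) _,
      Finset.sum_congr rfl fun j hj => Set.indicator_of_mem ((e2 j).2 hj) _]
    simp
  · have e1 : p.numCycles x F ω = ∞ := by
      simp only [Params.numCycles, iInf_eq_top]
      exact fun n hn hs => absurd ⟨n, hn, hs⟩ h
    have e2 : ∀ j, ω ∈ p.NoSuccess x F j := fun j n hn hs =>
      h ⟨n, (Finset.mem_Icc.1 hn).1, hs⟩
    rw [e1, tsum_congr fun j => Set.indicator_of_mem (e2 j) _]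
    exact (ENNReal.tsum_const_eq_top_of_ne_zero one_ne_zero).symm

section Measurability

variable {Ω : Type*} [MeasurableSpace Ω] {x : ℕ → Ω → ℂ} {F : ℕ → ℕ → Ω → ℝ}

lemma measurableSet_success (p : Params) (hx : ∀ i, Measurable (x i))
    (hF : ∀ i n, Measurable (F i n)) (n : ℕ) : MeasurableSet {ω | p.Success x F n ω} := by
  have hl := p.measurable_pathLoss
  have hsec : ∀ i b, MeasurableSet {ω | x b ω ∈ p.sector i} := fun i b =>
    hx b (p.measurableSet_sector i)
  have hbest : ∀ i a, MeasurableSet {ω | p.IsBestInSector x i a ω} := by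
    intro i a
    have e : {ω | p.IsBestInSector x i a ω} = {ω | x a ω ∈ p.sector i} ∩ ⋂ b,
        ({ω | x b ω ∈ p.sector i}ᶜ ∪ ({ω | p.pathLoss ‖x a ω‖ ≤ p.pathLoss ‖x b ω‖} ∩
          {ω | ‖x a ω‖ ≤ ‖x b ω‖})) := by
      ext ω
      simp [Params.IsBestInSector, imp_iff_not_or]
    rw [e]
    exact (hsec i a).inter (MeasurableSet.iInter fun b => (hsec i b).compl.union
      ((measurableSet_le (hl.comp (hx a).norm) (hl.comp (hx b).norm)).inter
        (measurableSet_le (hx a).norm (hx b).norm)))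
  have hrx : ∀ b, Measurable (p.rxPower x F n b) := fun b =>
    ((hF b n).div (hl.comp (hx b).norm)).ennreal_ofReal
  have hint : ∀ i a, Measurable (p.interference x F n i a) := by
    intro i a
    refine Measurable.tsum fun b => ?_
    by_cases hb : b = a
    · have : (fun ω => Set.indicator {b | b ≠ a ∧ x b ω ∈ p.sector i}
          (fun b => p.rxPower x F n b ω) b) = fun _ => 0 := by
        ext ω
        exact Set.indicator_of_notMem (fun h => h.1 hb) _
      rw [this]
      exact measurable_const
    · have : (fun ω => Set.indicator {b | b ≠ a ∧ x b ω ∈ p.sector i}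
          (fun b => p.rxPower x F n b ω) b)
          = {ω | x b ω ∈ p.sector i}.indicator (p.rxPower x F n b) := by
        ext ω
        by_cases h : x b ω ∈ p.sector i
        · rw [Set.indicator_of_mem (s := {b | b ≠ a ∧ x b ω ∈ p.sector i}) ⟨hb, h⟩,
            Set.indicator_of_mem (s := {ω | x b ω ∈ p.sector i}) h]
        · rw [Set.indicator_of_notMem (s := {b | b ≠ a ∧ x b ω ∈ p.sector i}) fun h' => h h'.2,
            Set.indicator_of_notMem (s := {ω | x b ω ∈ p.sector i}) h]
      rw [this]
      exact (hrx b).indicator (hsec i b)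
  have e : {ω | p.Success x F n ω} = ⋃ i, ⋃ a, {ω | p.IsBestInSector x i a ω} ∩
      {ω | ENNReal.ofReal p.Gam < p.sinr x F n i a ω} := by
    ext ω
    simp [Params.Success, Params.SectorDetected]
  rw [e]
  refine MeasurableSet.iUnion fun i => MeasurableSet.iUnion fun a => (hbest i a).inter ?_
  exact measurableSet_lt measurable_const ((hrx a).div ((hint i a).add_const _))

lemma measurableSet_noSuccess (p : Params) (hx : ∀ i, Measurable (x i))
    (hF : ∀ i n, Measurable (F i n)) (j : ℕ) : MeasurableSet (p.NoSuccess x F j) := by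
  have : p.NoSuccess x F j = ⋂ n ∈ Finset.Icc 1 j, {ω | p.Success x F n ω}ᶜ := by
    ext ω; simp [Params.NoSuccess]
  rw [this]
  exact Finset.measurableSet_biInter _ fun n _ => (measurableSet_success p hx hF n).compl

lemma measurable_numCycles (p : Params) (hx : ∀ i, Measurable (x i))
    (hF : ∀ i n, Measurable (F i n)) : Measurable (p.numCycles x F) := by
  rw [funext (numCycles_eq_tsum p x F)]
  exact Measurable.tsum fun j => measurable_one.indicator (measurableSet_noSuccess p hx hF j)

lemma measurable_nearestDist (hx : ∀ i, Measurable (x i)) : Measurable (nearestDist x) :=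
  Measurable.iInf fun i => (hx i).norm

end Measurability

/-! ### The conditional mean number of cycles -/

section Mean

variable {Ω : Type*} [MeasurableSpace Ω] {P : Measure Ω} [IsProbabilityMeasure P]
  {x : ℕ → Ω → ℂ} {F : ℕ → ℕ → Ω → ℝ} {p : Params}

/-- Stations and fadings are independent, so Fubini allows freezing the configuration; the inner
probability is then that of `measure_no_success`, and the outer average is
`lintegral_nearestDist_miss`. -/
lemma measure_noSuccess_inter (hp : p.Valid) (hnet : IsRayleighPoissonNetwork P p.lam x F) (j : ℕ)
    {B : Set ℝ} (hB : MeasurableSet B) :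
    P ({ω | nearestDist x ω ∈ B} ∩ p.NoSuccess x F j)
      = p.M * ∫⁻ r in B, p.missLaw j (Set.Ioi r) ^ (p.M - 1) ∂(p.missLaw j) := by
  have hx := hnet.poisson.measurable
  have hF := hnet.fading_measurable
  set X : Ω → ℕ → ℂ := fun ω i => x i ω with hX
  set Y : Ω → ℕ × ℕ → ℝ := fun ω q => F q.1 q.2 ω with hY
  have hXm : Measurable X := measurable_pi_lambda _ hx
  have hYm : Measurable Y := measurable_pi_lambda _ fun q => hF q.1 q.2
  -- The network is rebuilt from coordinates on the product space, so that the event becomes the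
  -- preimage of a measurable set `T` there.
  set x' : ℕ → (ℕ → ℂ) × (ℕ × ℕ → ℝ) → ℂ := fun b q => q.1 b with hx'
  set F' : ℕ → ℕ → (ℕ → ℂ) × (ℕ × ℕ → ℝ) → ℝ := fun b n q => q.2 (b, n) with hF'
  have hBm : MeasurableSet {ω | nearestDist x ω ∈ B} := measurable_nearestDist hx hB
  have hxm' : ∀ b, Measurable (x' b) := fun b => (measurable_pi_apply b).comp measurable_fst
  have hFm' : ∀ b n, Measurable (F' b n) := fun b n =>
    (measurable_pi_apply (b, n)).comp measurable_snd
  set T : Set ((ℕ → ℂ) × (ℕ × ℕ → ℝ)) := {q | nearestDist x' q ∈ B} ∩ p.NoSuccess x' F' j with hT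
  have hTm : MeasurableSet T :=
    (measurable_nearestDist hxm' hB).inter (measurableSet_noSuccess p hxm' hFm' j)
  have hpre : {ω | nearestDist x ω ∈ B} ∩ p.NoSuccess x F j = (fun ω => (X ω, Y ω)) ⁻¹' T := rfl
  rw [hpre, ← Measure.map_apply (hXm.prodMk hYm) hTm,
    (indepFun_iff_map_prod_eq_prod_map_map hXm.aemeasurable hYm.aemeasurable).1 hnet.fading_indep,
    Measure.prod_apply hTm, lintegral_map (measurable_measure_prodMk_left hTm) hXm,
    ← lintegral_nearestDist_miss hnet.poisson hp j hB,
    ← lintegral_indicator hBm]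
  refine lintegral_congr_ae ?_
  filter_upwards [hnet.poisson.ae_uniqueBest hp] with ω hω
  choose a ha using hω
  rw [Measure.map_apply hYm (measurable_prodMk_left hTm)]
  by_cases hωB : nearestDist x ω ∈ B
  · rw [Set.indicator_of_mem (s := {ω | nearestDist x ω ∈ B}) hωB]
    have e1 : Y ⁻¹' (Prod.mk (X ω) ⁻¹' T)
        = {ω' | ∀ n ∈ Finset.Icc 1 j, ¬ p.Success (fun b _ => x b ω) F n ω'} := by
      ext ω'
      exact ⟨fun h => h.2, fun h => ⟨hωB, h⟩⟩
    rw [e1, measure_no_success hp hF hnet.fading_law hnet.fading_iIndep ha j]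
    refine Finset.prod_congr rfl fun i _ => ?_
    rw [Params.missProb, (ha i).secRad_eq]
  · rw [Set.indicator_of_notMem (s := {ω | nearestDist x ω ∈ B}) hωB]
    have e1 : Y ⁻¹' (Prod.mk (X ω) ⁻¹' T) = ∅ :=
      Set.eq_empty_of_forall_notMem fun ω' h => hωB h.1
    rw [e1, measure_empty]

/-! ### Law of the nearest distance, and the terms of the series as ratios of densities. -/

lemma Params.f_zero (p : Params) (r : ℝ) : p.f 0 r = 1 := by
  simp [Params.f]

lemma Params.missLaw_zero (p : Params) : p.missLaw 0 = p.radLaw := by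
  rw [Params.missLaw]
  simp_rw [p.f_zero]
  simp

/-- The law of the distance to the nearest BS. -/
lemma map_nearestDist (hp : p.Valid) (h : IsPoissonProcess P p.lam x) :
    P.map (nearestDist x)
      = p.radLaw.withDensity fun r => p.M * p.radLaw (Set.Ioi r) ^ (p.M - 1) := by
  have := hp.isProbabilityMeasure_radLaw
  ext B hB
  -- For `j = 0` the miss probabilities are 1, so only the probability that the distance lies in `B`
  -- remains.
  have h1 := lintegral_nearestDist_miss h hp 0 hB
  rw [Measure.map_apply (measurable_nearestDist h.measurable) hB, withDensity_apply _ hB,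
    lintegral_const_mul' _ _ (ENNReal.natCast_ne_top _), ← p.missLaw_zero, ← h1]
  simp [Params.missProb]
  rfl

lemma integrableOn_f_mul_sectorDensity (h : IsPoissonProcess P p.lam x) (hp : p.Valid) (j : ℕ)
    {r : ℝ} (hr : 0 < r) :
    IntegrableOn (fun t => p.f j t * p.sectorDensity t) (Set.Ioi r) := by
  refine (hp.integrableOn_sectorDensity hr.le).bdd_mul (c := 1)
    (p.measurable_f j).aestronglyMeasurable ?_
  refine (ae_restrict_iff' measurableSet_Ioi).2 (ae_of_all _ fun t ht => ?_)
  have ht0 : 0 < t := hr.trans ht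
  rw [Real.norm_of_nonneg (f_nonneg h hp j ht0)]
  exact f_le_one h hp j ht0

lemma missLaw_Ioi (h : IsPoissonProcess P p.lam x) (hp : p.Valid) (j : ℕ) {r : ℝ} (hr : 0 < r) :
    p.missLaw j (Set.Ioi r) = ENNReal.ofReal (∫ t in Set.Ioi r, p.f j t * p.sectorDensity t) := by
  rw [ofReal_integral_eq_lintegral_ofReal (integrableOn_f_mul_sectorDensity h hp j hr)
    ((ae_restrict_iff' measurableSet_Ioi).2 (ae_of_all _ fun t ht =>
      mul_nonneg (f_nonneg h hp j (hr.trans ht)) (hp.sectorDensity_nonneg (hr.trans ht).le))),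
    Params.missLaw, withDensity_apply _ measurableSet_Ioi, Params.radLaw,
    setLIntegral_withDensity_eq_setLIntegral_mul _
      p.continuous_sectorDensity.measurable.ennreal_ofReal (p.measurable_f j).ennreal_ofReal
      measurableSet_Ioi, Measure.restrict_restrict measurableSet_Ioi, Set.Ioi_inter_Ioi,
    max_eq_left hr.le]
  refine setLIntegral_congr_fun measurableSet_Ioi fun t ht => ?_
  have ht0 : 0 < t := hr.trans ht
  rw [Pi.mul_apply, mul_comm, ← ENNReal.ofReal_mul (f_nonneg h hp j ht0)]

/-- The exponential factor of `term` is the reciprocal of `radLaw (Ioi r) ^ (M - 1)`, so `term j` is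
the density of `R₀` on the event of `j` failures divided by the density of `R₀`. The product form
avoids division in `[0, ∞]`. -/
lemma ofReal_term_mul (h : IsPoissonProcess P p.lam x) (hp : p.Valid) (j : ℕ) {r : ℝ}
    (hr : 0 < r) :
    p.radLaw (Set.Ioi r) ^ (p.M - 1) * ENNReal.ofReal (p.term j r)
      = ENNReal.ofReal (p.f j r) * p.missLaw j (Set.Ioi r) ^ (p.M - 1) := by
  have hI : 0 ≤ ∫ t in Set.Ioi r, p.f j t * p.sectorDensity t :=
    setIntegral_nonneg measurableSet_Ioi fun t ht =>
      mul_nonneg (f_nonneg h hp j (hr.trans ht)) (hp.sectorDensity_nonneg (hr.trans ht).le)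
  rw [hp.radLaw_Ioi hr.le, missLaw_Ioi h hp j hr, ← ENNReal.ofReal_pow (Real.exp_pos _).le,
    ← ENNReal.ofReal_pow hI, ← ENNReal.ofReal_mul (by positivity),
    ← ENNReal.ofReal_mul (f_nonneg h hp j hr)]
  congr 1
  have hexp : Real.exp (-(p.lam * Real.pi * r ^ 2 / p.M)) ^ (p.M - 1) *
      Real.exp (p.lam * Real.pi * ((p.M : ℝ) - 1) * r ^ 2 / p.M) = 1 := by
    rw [← Real.exp_nat_mul, ← Real.exp_add, Nat.cast_sub hp.M_pos]
    convert Real.exp_zero using 2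
    push_cast
    ring
  rw [Params.term]
  linear_combination (p.f j r * (∫ t in Set.Ioi r, p.f j t * p.sectorDensity t) ^ (p.M - 1)) * hexp

lemma Params.measurable_term (p : Params) (j : ℕ) : Measurable (p.term j) := by
  have hf := p.measurable_f j
  have hd := p.continuous_sectorDensity.measurable
  have hI : Measurable fun r => ∫ t in Set.Ioi r, p.f j t * p.sectorDensity t := by
    have e : ∀ r, ∫ t in Set.Ioi r, p.f j t * p.sectorDensity t
        = ∫ t, {q : ℝ × ℝ | q.1 < q.2}.indicator (fun q => p.f j q.2 * p.sectorDensity q.2)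
          (r, t) := by
      intro r
      rw [← integral_indicator measurableSet_Ioi]
      rfl
    simp_rw [e]
    refine (StronglyMeasurable.integral_prod_right' (Measurable.stronglyMeasurable
      (Measurable.indicator ?_ (measurableSet_lt measurable_fst measurable_snd)))).measurable
    exact (hf.comp measurable_snd).mul (hd.comp measurable_snd)
  exact (hf.mul (hI.pow_const _)).mul (by fun_prop)

/-- Monotone convergence reduces this to one `j`. Both sides then become integrals against `radLaw`
over `B` with the same factor `M`, and the integrands agree by `ofReal_term_mul`. -/
lemma setLIntegral_numCycles (hp : p.Valid) (hnet : IsRayleighPoissonNetwork P p.lam x F)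
    {B : Set ℝ} (hB : MeasurableSet B) :
    ∫⁻ ω in nearestDist x ⁻¹' B, ∑' j, ENNReal.ofReal (p.term j (nearestDist x ω)) ∂P
      = ∫⁻ ω in nearestDist x ⁻¹' B, p.numCycles x F ω ∂P := by
  have hx := hnet.poisson.measurable
  have hR := measurable_nearestDist hx
  have hns := measurableSet_noSuccess p hx hnet.fading_measurable
  have := hp.isProbabilityMeasure_radLaw
  have htm : ∀ j, Measurable fun r => ENNReal.ofReal (p.term j r) := fun j =>
    (p.measurable_term j).ennreal_ofReal
  have htm' : ∀ j, Measurable fun ω => ENNReal.ofReal (p.term j (nearestDist x ω)) :=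
    fun j => (htm j).comp hR
  simp_rw [numCycles_eq_tsum]
  rw [lintegral_tsum fun j => (htm' j).aemeasurable,
    lintegral_tsum fun j => (measurable_one.indicator (hns j)).aemeasurable]
  congr 1
  ext j
  have hIoi : Measurable fun r => p.radLaw (Set.Ioi r) :=
    Antitone.measurable fun a b hab => measure_mono (Set.Ioi_subset_Ioi hab)
  have hIoi' : Measurable fun r => p.missLaw j (Set.Ioi r) :=
    Antitone.measurable fun a b hab => measure_mono (Set.Ioi_subset_Ioi hab)
  rw [lintegral_indicator_one (hns j), Measure.restrict_apply (hns j), Set.inter_comm]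
  have hmiss : ∫⁻ r in B, p.missLaw j (Set.Ioi r) ^ (p.M - 1) ∂(p.missLaw j)
      = ∫⁻ r in B, ENNReal.ofReal (p.f j r) * p.missLaw j (Set.Ioi r) ^ (p.M - 1) ∂p.radLaw :=
    setLIntegral_withDensity_eq_setLIntegral_mul _
      (p.measurable_f j).ennreal_ofReal (hIoi'.pow_const _) hB
  refine Eq.trans ?_ (measure_noSuccess_inter hp hnet j hB).symm
  rw [← setLIntegral_map hB (htm j) hR, map_nearestDist hp hnet.poisson,
    setLIntegral_withDensity_eq_setLIntegral_mul _ ((hIoi.pow_const _).const_mul _) (htm j) hB,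
    hmiss,
    ← lintegral_const_mul' _ _ (ENNReal.natCast_ne_top _)]
  refine lintegral_congr_ae (ae_restrict_of_ae ?_)
  filter_upwards [p.ae_radLaw_pos] with r hr
  simp only [Pi.mul_apply]
  rw [mul_assoc, ofReal_term_mul hnet.poisson hp j hr]

end Mean

end CellSearch

theorem mainTheorem9 {Ω : Type*} [MeasurableSpace Ω] (P : Measure Ω) [IsProbabilityMeasure P]
    (p : CellSearch.Params) (hp : p.Valid) (x : ℕ → Ω → ℂ) (F : ℕ → ℕ → Ω → ℝ)
    (hnet : CellSearch.IsRayleighPoissonNetwork P p.lam x F) :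
    Measurable (p.numCycles x F) ∧
    (∀ (j : ℕ) (r : ℝ), 0 < r → 0 ≤ p.f j r) ∧
    (∀ (j : ℕ) (r : ℝ), 0 < r →
      IntegrableOn (fun t => p.f j t * p.sectorDensity t) (Set.Ioi r)) ∧
    P⁻[p.numCycles x F | MeasurableSpace.comap (CellSearch.nearestDist x) inferInstance] =ᵐ[P]
      fun ω => ∑' j : ℕ, ENNReal.ofReal (p.term j (CellSearch.nearestDist x ω)) := by
  have hx := hnet.poisson.measurable
  have hR := CellSearch.measurable_nearestDist hx
  refine ⟨CellSearch.measurable_numCycles p hx hnet.fading_measurable,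
    fun j r hr => CellSearch.f_nonneg hnet.poisson hp j hr,
    fun j r hr => CellSearch.integrableOn_f_mul_sectorDensity hnet.poisson hp j hr, ?_⟩
  -- The conditional expectation is taken in `[0, ∞]`, so no integrability of the number of cycles
  -- is needed: measurability in `R₀` and equal integrals over the events `{R₀ ∈ B}` suffice.
  refine (ae_eq_condLExp hR.comap_le P _ ?_ ?_).symm
  · have h1 : Measurable fun r => ∑' j : ℕ, ENNReal.ofReal (p.term j r) :=
      Measurable.tsum fun j => (p.measurable_term j).ennreal_ofReal
    exact h1.comp (comap_measurable _)
  · rintro _ ⟨B, hB, rfl⟩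
    exact CellSearch.setLIntegral_numCycles hp hnet hB
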